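/- Let $K\subset\mathbb{R}^d$ be a polytope with the origin in its interior. For $a\neq b$ in $\mathbb{R}^d$ let $\operatorname{dist}(a,b)$ be the unique $\alpha>0$ with $b-a\in\partial(\alpha K)$, and let $\operatorname{dist}(a,a)=0$. Let $S=\{a_1,a_2,a_3\}$ be a set of three distinct points of $\mathbb{R}^d$ in weak general position with respect to $K$, that is, no two distinct points of $S$ lie in a common hyperplane parallel to a facet of $K$. For $a\in S$ let the sector $H_S(a)$ be the set of all $x\in\partial K$ such that $\ell(b-a)>0$ for every $b\in S\setminus\{a\}$ and every nonzero linear functional $\ell$ in the exterior normal cone of $K$ at $x$ (that is, with $\ell(y)\le\ell(x)$ for all $y\in K$). If $H_S(a_i)\neq\emptyset$ for $i=1,2,3$, then $d\ge 2$ and the bisector $$\operatorname{bis}(a_1,a_2,a_3)=\{x\in\mathbb{R}^d : \operatorname{dist}(a_1,x)=\operatorname{dist}(a_2,x)=\operatorname{dist}(a_3,x)\}$$ is homeomorphic to a non-empty open subset of $\mathbb{R}^{d-2}$. -/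

import Mathlib

noncomputable section

namespace PolyhedralNorm

open scoped Pointwise

variable {d : ℕ}

/-- A polytope in `ℝ^d`: the convex hull of finitely many points. -/
def IsPolytope (K : Set (EuclideanSpace ℝ (Fin d))) : Prop :=
  ∃ V : Set (EuclideanSpace ℝ (Fin d)), V.Finite ∧ K = convexHull ℝ V

/-- The (possibly asymmetric) distance with unit ball `K`: the scaling factor `α` for which
`b - a` lies on the boundary of `α • K`, given by the Minkowski functional (gauge) of `K`. -/
def mdist (K : Set (EuclideanSpace ℝ (Fin d))) (a b : EuclideanSpace ℝ (Fin d)) : ℝ :=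
  gauge K (b - a)

/-- For distinct points, `mdist K a b` is the unique `α > 0` with `b - a ∈ ∂(α K)`. -/
theorem mdist_eq_iff {K : Set (EuclideanSpace ℝ (Fin d))} (hK : IsPolytope K)
    (h0 : (0 : EuclideanSpace ℝ (Fin d)) ∈ interior K) {a b : EuclideanSpace ℝ (Fin d)}
    (hab : a ≠ b) (α : ℝ) :
    mdist K a b = α ↔ 0 < α ∧ b - a ∈ frontier (α • K) := by
  obtain ⟨V, hV, rfl⟩ := hK
  have hc : Convex ℝ (convexHull ℝ V) := convex_convexHull ℝ V
  have hn : convexHull ℝ V ∈ nhds (0 : EuclideanSpace ℝ (Fin d)) :=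
    mem_interior_iff_mem_nhds.mp h0
  have hb : Bornology.IsBounded (convexHull ℝ V) := isBounded_convexHull.mpr hV.isBounded
  have hpos : 0 < gauge (convexHull ℝ V) (b - a) :=
    (gauge_pos (absorbent_nhds_zero hn)
      ((NormedSpace.isVonNBounded_iff ℝ).mpr hb)).mpr (sub_ne_zero.mpr hab.symm)
  have key : ∀ α : ℝ, 0 < α → (b - a ∈ frontier (α • convexHull ℝ V) ↔
      gauge (convexHull ℝ V) (b - a) = α) := by
    intro α hα
    have e : frontier (α • convexHull ℝ V) = α • frontier (convexHull ℝ V) := by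
      simp only [frontier, closure_smul₀, interior_smul₀ hα.ne', Set.smul_set_sdiff₀ hα.ne']
    rw [e, Set.mem_smul_set_iff_inv_smul_mem₀ hα.ne', ← gauge_eq_one_iff_mem_frontier hc hn,
      gauge_smul_of_nonneg (inv_nonneg.mpr hα.le), smul_eq_mul, inv_mul_eq_one₀ hα.ne', eq_comm]
  constructor
  · rintro rfl
    exact ⟨hpos, (key _ hpos).mpr rfl⟩
  · rintro ⟨hα, h⟩
    exact (key α hα).mp h

/-- The bisector of a set of sites: the points at equal distance from all sites. -/
def bis (K S : Set (EuclideanSpace ℝ (Fin d))) : Set (EuclideanSpace ℝ (Fin d)) :=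
  {x | ∀ a ∈ S, ∀ b ∈ S, mdist K a x = mdist K b x}

/-- A facet of a polytope `K` with interior points: a nonempty (exposed) face of dimension
`d - 1`. -/
def IsFacet (K F : Set (EuclideanSpace ℝ (Fin d))) : Prop :=
  F.Nonempty ∧ IsExposed ℝ K F ∧ Module.finrank ℝ (vectorSpan ℝ F) + 1 = d

/-- Weak general position: no two distinct sites lie in a common hyperplane parallel to a facet
of `K`. -/
def WeakGeneralPosition (K S : Set (EuclideanSpace ℝ (Fin d))) : Prop :=
  ∀ a ∈ S, ∀ b ∈ S, a ≠ b → ∀ F, IsFacet K F →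
    ¬ ∃ H : AffineSubspace ℝ (EuclideanSpace ℝ (Fin d)),
      H.Parallel (affineSpan ℝ F) ∧ a ∈ H ∧ b ∈ H

/-- The exterior normal cone of `K` at `x`, as a set of linear functionals. -/
def normalCone (K : Set (EuclideanSpace ℝ (Fin d))) (x : EuclideanSpace ℝ (Fin d)) :
    Set (EuclideanSpace ℝ (Fin d) →L[ℝ] ℝ) :=
  {l | ∀ y ∈ K, l y ≤ l x}

/-- The open halfsphere of `∂K` in the direction `v`: the boundary points all of whose nonzero
exterior normals are positive on `v`. -/
def halfsphere (K : Set (EuclideanSpace ℝ (Fin d))) (v : EuclideanSpace ℝ (Fin d)) :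
    Set (EuclideanSpace ℝ (Fin d)) :=
  {x ∈ frontier K | ∀ l ∈ normalCone K x, l ≠ 0 → 0 < l v}

/-- The sector of the site `a`: the points of `∂K` in the halfspheres in the directions `b - a`
for all other sites `b`. -/
def sector (K S : Set (EuclideanSpace ℝ (Fin d))) (a : EuclideanSpace ℝ (Fin d)) :
    Set (EuclideanSpace ℝ (Fin d)) :=
  {x ∈ frontier K | ∀ b ∈ S \ {a}, x ∈ halfsphere K (b - a)}

end PolyhedralNorm

end

/-!
Let `g` be the gauge of `K`, so that `dist(a, x) = g (x - a)`. The extreme points of the polar of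
`K` form a finite set `N` of linear functionals whose maximum is `g` (`isMaxOf_gauge`), and each of
them cuts out a facet; weak general position therefore says that no functional in `N` takes the
same value at two of the sites (`apply_sub_ne_zero_of_weakGeneralPosition`).

For `x` on the bisector let `r = 1 / dist(a₁, x)` and `yᵢ = r (x - aᵢ)`. The points `yᵢ` are the
vertices of a homothetic copy, of ratio `-r`, of the triangle of the sites, inscribed in `∂K`.
If `n ∈ N` is active at `yᵢ`, meaning `n yᵢ = g yᵢ`, then comparing its values at the three vertices
gives `n (aⱼ - aᵢ) > 0` for `j ≠ i`. The homothetic copies in the translates of the plane of the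
triangle are parametrized by `γ ∈ ℝ³`, the vertex `yᵢ` moving by `∑ⱼ γⱼ (aⱼ - aᵢ)` and `r` by
`γ₁ + γ₂ + γ₃`. So `g yᵢ` does not depend on `γᵢ` and, near an inscribed copy, increases in the
other two coordinates. Consequently:

* each translate of the plane contains at most one inscribed copy: between two of them, any two
  of the coordinates `γᵢ` would either both vanish or have strictly opposite signs, which forces
  `γ = 0` (`IsMaxOf.coeff_eq_zero`);
* an inscribed copy persists under small translations of the plane, by solving three monotone
  equations (`eventually_exists_solution`).

Let `p` be a linear map onto `ℝ^(d - 2)` whose kernel is the direction of that plane. Then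
`x ↦ p (x - a₁) / dist(a₁, x)` is an open embedding of the bisector
(`IsMaxOf.isOpenEmbedding_bisector`), and its image is the required open set. That the plane really
is two-dimensional follows from the same sign argument, applied to points of the three sectors.

The bisector is non-empty because the bisector of any two sites is connected, being a graph over
the hyperplanes transversal to the line through them (`IsMaxOf.isPreconnected_bisector`), while
every site is somewhere the closest (at itself) and, its sector being non-empty, somewhere the
farthest. By connectedness of `ℝ^d`, some pair of sites is jointly closest at one point and jointly
farthest at another; along the bisector of that pair the distance to the third site has to agree
with the common distance somewhere (`exists_eq_of_isPreconnected`).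
-/

open Set Filter Topology

namespace PolyhedralNorm

/-! ### Gauges of polytopes as maxima of facet functionals -/

section Gauge

variable {E : Type*} [NormedAddCommGroup E] [NormedSpace ℝ E]

/-- `g` is the pointwise maximum of the finite family `N` of linear functionals. -/
structure IsMaxOf (g : E → ℝ) (N : Set (E →L[ℝ] ℝ)) : Prop where
  finite : N.Finite
  le : ∀ n ∈ N, ∀ y, n y ≤ g y
  exists_eq : ∀ y, ∃ n ∈ N, n y = g y

/-- The one-sided polar of a set `V`. -/
def polarSet (V : Set E) : Set (E →L[ℝ] ℝ) := {l | ∀ v ∈ V, l v ≤ 1}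

lemma polarSet_convexHull {V : Set E} {l : E →L[ℝ] ℝ} (hl : l ∈ polarSet V) :
    ∀ y ∈ convexHull ℝ V, l y ≤ 1 := by
  intro y hy
  have : convexHull ℝ V ⊆ {y | l y ≤ 1} :=
    convexHull_min hl (convex_halfSpace_le l.toLinearMap.isLinear 1)
  exact this hy

lemma isCompact_polarSet [FiniteDimensional ℝ E] {V : Set E}
    (h0 : convexHull ℝ V ∈ 𝓝 (0 : E)) : IsCompact (polarSet V) := by
  refine Metric.isCompact_of_isClosed_isBounded ?_ ?_
  · have : polarSet V = ⋂ v ∈ V, {l : E →L[ℝ] ℝ | l v ≤ 1} := by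
      ext l; simp [polarSet]
    rw [this]
    exact isClosed_biInter fun v _ =>
      isClosed_le (ContinuousLinearMap.apply ℝ ℝ v).continuous continuous_const
  · obtain ⟨r, hr, hb⟩ := Metric.mem_nhds_iff.mp h0
    refine (NormedSpace.isBounded_polar_of_mem_nhds_zero ℝ (Metric.ball_mem_nhds 0 hr)).subset
      fun l hl x hx => ?_
    have h1 := polarSet_convexHull hl x (hb hx)
    have h2 := polarSet_convexHull hl (-x) (hb (by simpa using hx))
    rw [map_neg] at h2
    have h3 : |l x| ≤ 1 := abs_le.mpr ⟨by linarith, h1⟩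
    exact h3

lemma apply_le_gauge {V : Set E} (h0 : convexHull ℝ V ∈ 𝓝 (0 : E)) {l : E →L[ℝ] ℝ}
    (hl : l ∈ polarSet V) (y : E) : l y ≤ gauge (convexHull ℝ V) y := by
  refine le_of_forall_gt_imp_ge_of_dense fun r hr => ?_
  obtain ⟨b, hb, hbr, k, hk, rfl⟩ := exists_lt_of_gauge_lt (absorbent_nhds_zero h0) hr
  have := polarSet_convexHull hl k hk
  simp only [map_smul, smul_eq_mul]
  nlinarith

/-- Every point has a supporting functional in the polar set (Hahn–Banach). -/
lemma exists_polarSet_eq_gauge {V : Set E} (hV : V.Finite) (h0 : convexHull ℝ V ∈ 𝓝 (0 : E))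
    (y : E) : ∃ l ∈ polarSet V, l y = gauge (convexHull ℝ V) y := by
  set K := convexHull ℝ V with hK
  have hc : Convex ℝ K := convex_convexHull ℝ V
  have hi : (0 : E) ∈ interior K := mem_interior_iff_mem_nhds.mpr h0
  have hb : Bornology.IsVonNBounded ℝ K :=
    (NormedSpace.isVonNBounded_iff ℝ).mpr (isBounded_convexHull.mpr hV.isBounded)
  rcases eq_or_ne y 0 with rfl | hy
  · exact ⟨0, fun v _ => by simp, by simp⟩
  have hg : 0 < gauge K y := (gauge_pos (absorbent_nhds_zero h0) hb).mpr hy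
  have hni : (gauge K y)⁻¹ • y ∉ interior K := by
    intro h
    rw [← gauge_lt_one_iff_mem_interior hc h0, gauge_smul_of_nonneg (by positivity),
      smul_eq_mul, inv_mul_cancel₀ hg.ne'] at h
    exact lt_irrefl _ h
  obtain ⟨f, hf⟩ := geometric_hahn_banach_open_point hc.interior isOpen_interior hni
  have hp : 0 < f ((gauge K y)⁻¹ • y) := by simpa using hf 0 hi
  have hle : ∀ k ∈ K, f k ≤ f ((gauge K y)⁻¹ • y) := by
    intro k hk
    have hk' : k ∈ closure (interior K) := by
      rw [hc.closure_interior_eq_closure_of_nonempty_interior ⟨0, hi⟩]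
      exact subset_closure hk
    exact closure_minimal (t := {k | f k ≤ f ((gauge K y)⁻¹ • y)}) (fun k hk => (hf k hk).le)
      (isClosed_le f.continuous continuous_const) hk'
  refine ⟨(f ((gauge K y)⁻¹ • y))⁻¹ • f, fun v hv => ?_, ?_⟩
  · have := hle v (subset_convexHull ℝ V hv)
    rw [smul_apply, smul_eq_mul, inv_mul_le_one₀ hp]
    exact this
  · have hfy : f y ≠ 0 := by
      intro h
      simp [h] at hp
    simp only [map_smul, smul_eq_mul, smul_apply]
    field_simp

/-- A perturbation of an element of the polar of a finite set which does not change the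
values on the points where the constraint is tight stays in the polar when it is small. -/
lemma exists_pos_add_smul_mem_polarSet {V : Set E} (hV : V.Finite) {l m : E →L[ℝ] ℝ}
    (hl : l ∈ polarSet V) (hm : ∀ v ∈ V, l v = 1 → m v = 0) :
    ∃ ε : ℝ, 0 < ε ∧ l + ε • m ∈ polarSet V ∧ l - ε • m ∈ polarSet V := by
  have key : ∀ v ∈ V, ∀ᶠ ε : ℝ in 𝓝 0, l v + ε * m v ≤ 1 ∧ l v - ε * m v ≤ 1 := by
    intro v hv
    rcases (hl v hv).eq_or_lt with h | h
    · exact Eventually.of_forall fun ε => by simp [hm v hv h, h]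
    · have h1 : Tendsto (fun ε : ℝ => l v + ε * m v) (𝓝 0) (𝓝 (l v + 0 * m v)) :=
        (by fun_prop : Continuous fun ε : ℝ => l v + ε * m v).tendsto 0
      have h2 : Tendsto (fun ε : ℝ => l v - ε * m v) (𝓝 0) (𝓝 (l v - 0 * m v)) :=
        (by fun_prop : Continuous fun ε : ℝ => l v - ε * m v).tendsto 0
      filter_upwards [h1.eventually (gt_mem_nhds (by simpa using h)),
        h2.eventually (gt_mem_nhds (by simpa using h))] with ε e1 e2
      exact ⟨e1.le, e2.le⟩
  have h2 := (hV.eventually_all.mpr key)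
  obtain ⟨ε, hε, hpos⟩ := ((h2.filter_mono nhdsWithin_le_nhds).and
    (self_mem_nhdsWithin (s := Ioi (0 : ℝ)))).exists
  exact ⟨ε, hpos, fun v hv => by simpa using (hε v hv).1, fun v hv => by simpa using (hε v hv).2⟩

lemma eq_zero_of_mem_extremePoints_polarSet {V : Set E} (hV : V.Finite) {l m : E →L[ℝ] ℝ}
    (hl : l ∈ (polarSet V).extremePoints ℝ) (hm : ∀ v ∈ V, l v = 1 → m v = 0) : m = 0 := by
  obtain ⟨ε, hε, h1, h2⟩ := exists_pos_add_smul_mem_polarSet hV hl.1 hm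
  have := hl.2 h1 h2 ⟨1 / 2, 1 / 2, by norm_num, by norm_num, by norm_num, by module⟩
  have h3 : ε • m = 0 := by simpa using this
  exact (smul_eq_zero.mp h3).resolve_left hε.ne'

/-- An extreme point of the polar is determined by its set of tight constraints. -/
lemma finite_extremePoints_polarSet {V : Set E} (hV : V.Finite) :
    ((polarSet V).extremePoints ℝ).Finite := by
  refine Set.Finite.of_finite_image (f := fun l : E →L[ℝ] ℝ => {v ∈ V | l v = 1}) ?_ ?_
  · exact hV.finite_subsets.subset (by rintro _ ⟨l, -, rfl⟩; exact sep_subset _ _)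
  · intro l hl l' hl' h
    have := eq_zero_of_mem_extremePoints_polarSet hV hl (m := l - l') (fun v hv h1 => by
      have hv' : v ∈ {v ∈ V | l' v = 1} := by
        simp only at h
        rw [← h]; exact ⟨hv, h1⟩
      simp [h1, hv'.2])
    exact sub_eq_zero.mp this

/-- The gauge of a polytope is the maximum of the extreme points of its polar. -/
lemma isMaxOf_gauge [FiniteDimensional ℝ E] {V : Set E} (hV : V.Finite)
    (h0 : convexHull ℝ V ∈ 𝓝 (0 : E)) :
    IsMaxOf (gauge (convexHull ℝ V)) ((polarSet V).extremePoints ℝ) := by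
  refine ⟨finite_extremePoints_polarSet hV, fun n hn y => apply_le_gauge h0 hn.1 y, fun y => ?_⟩
  obtain ⟨l, hl, hly⟩ := exists_polarSet_eq_gauge hV h0 y
  have hexp : IsExposed ℝ (polarSet V) {n ∈ polarSet V | n y = gauge (convexHull ℝ V) y} := by
    intro _
    refine ⟨ContinuousLinearMap.apply ℝ ℝ y, ?_⟩
    ext n
    simp only [mem_ofPred_eq, ContinuousLinearMap.apply_apply]
    refine and_congr_right fun hn => ⟨fun h m hm => h ▸ apply_le_gauge h0 hm y, fun h => ?_⟩
    exact le_antisymm (apply_le_gauge h0 hn y) (hly ▸ h l hl)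
  obtain ⟨n, hn⟩ := (hexp.isCompact (isCompact_polarSet h0)).extremePoints_nonempty ⟨l, hl, hly⟩
  exact ⟨n, hexp.isExtreme.extremePoints_subset_extremePoints hn, hn.1.2⟩

/-- An extreme point of the polar takes the value `1` on a spanning subset of `V`; otherwise it could
be moved in both directions along a functional that vanishes on that subset. -/
lemma span_eq_top_of_mem_extremePoints_polarSet [FiniteDimensional ℝ E] {V : Set E}
    (hV : V.Finite) {l : E →L[ℝ] ℝ} (hl : l ∈ (polarSet V).extremePoints ℝ) :
    Submodule.span ℝ {v ∈ V | l v = 1} = ⊤ := by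
  by_contra h
  obtain ⟨f, hf, hle⟩ := Submodule.exists_le_ker_of_lt_top _ (lt_top_iff_ne_top.mpr h)
  have h1 := eq_zero_of_mem_extremePoints_polarSet hV hl (m := LinearMap.toContinuousLinearMap f)
    (fun v hv h1 => by simpa using hle (Submodule.subset_span ⟨hv, h1⟩))
  exact hf (by simpa using h1)

end Gauge

section Facet

variable {d : ℕ}

local notation "𝔼" => EuclideanSpace ℝ (Fin d)

/-- The face `{l = 1}` cut out by an extreme point `l` of the polar is a facet, and its direction
is the kernel of `l`. -/
lemma isFacet_of_mem_extremePoints_polarSet (hd : 0 < d) {V : Set 𝔼} (hV : V.Finite)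
    {l : 𝔼 →L[ℝ] ℝ} (hl : l ∈ (polarSet V).extremePoints ℝ) :
    IsFacet (convexHull ℝ V) {y ∈ convexHull ℝ V | l y = 1} ∧
      vectorSpan ℝ {y ∈ convexHull ℝ V | l y = 1} = LinearMap.ker l.toLinearMap := by
  set F := {y ∈ convexHull ℝ V | l y = 1} with hF
  have hspan := span_eq_top_of_mem_extremePoints_polarSet hV hl
  have hVF : {v ∈ V | l v = 1} ⊆ F := fun v hv => ⟨subset_convexHull ℝ V hv.1, hv.2⟩
  have hspanF : Submodule.span ℝ F = ⊤ := top_le_iff.mp (hspan ▸ Submodule.span_mono hVF)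
  have : Nontrivial 𝔼 := by
    have : Nonempty (Fin d) := ⟨⟨0, hd⟩⟩
    infer_instance
  obtain ⟨p, hp⟩ : F.Nonempty := by
    by_contra h
    rw [not_nonempty_iff_eq_empty] at h
    rw [h, Submodule.span_empty] at hspanF
    exact bot_ne_top hspanF
  have hle : vectorSpan ℝ F ≤ LinearMap.ker l.toLinearMap := by
    rw [vectorSpan_def, Submodule.span_le]
    rintro _ ⟨x, hx, y, hy, rfl⟩
    simp [hx.2, hy.2]
  have htop : ∀ x, ∃ c : ℝ, x - c • p ∈ vectorSpan ℝ F := by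
    intro x
    have hx : x ∈ Submodule.span ℝ F := hspanF ▸ Submodule.mem_top
    induction hx using Submodule.span_induction with
    | mem x hx => exact ⟨1, by simpa using vsub_mem_vectorSpan ℝ hx hp⟩
    | zero => exact ⟨0, by simp⟩
    | add x y _ _ hx hy =>
      obtain ⟨c, hc⟩ := hx
      obtain ⟨e, he⟩ := hy
      exact ⟨c + e, by convert add_mem hc he using 1; module⟩
    | smul r x _ hx =>
      obtain ⟨c, hc⟩ := hx
      exact ⟨r * c, by convert Submodule.smul_mem _ r hc using 1; module⟩
  have heq : vectorSpan ℝ F = LinearMap.ker l.toLinearMap := by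
    refine le_antisymm hle fun x hx => ?_
    obtain ⟨c, hc⟩ := htop x
    have h1 : l (x - c • p) = 0 := hle hc
    have h2 : l x = 0 := hx
    have h3 : c = 0 := by simpa [h2, hp.2] using h1
    simpa [h3] using hc
  refine ⟨⟨⟨p, hp⟩, ?_, ?_⟩, heq⟩
  · intro _
    refine ⟨l, ?_⟩
    ext y
    refine and_congr_right fun hy => ⟨fun h z hz => h ▸ polarSet_convexHull hl.1 z hz, fun h => ?_⟩
    exact le_antisymm (polarSet_convexHull hl.1 y hy) (hp.2 ▸ h p hp.1)
  · rw [heq]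
    have hne : l.toLinearMap ≠ 0 := by
      intro h
      have := hp.2
      have h2 : l p = 0 := by simpa using LinearMap.congr_fun h p
      linarith
    have := Module.Dual.finrank_ker_add_one_of_ne_zero hne
    simpa using this

/-- The facet functionals of `K` separate sites in weak general position. -/
lemma apply_sub_ne_zero_of_weakGeneralPosition {V S : Set 𝔼} (hV : V.Finite)
    (hgp : WeakGeneralPosition (convexHull ℝ V) S) {l : 𝔼 →L[ℝ] ℝ}
    (hl : l ∈ (polarSet V).extremePoints ℝ) {a b : 𝔼} (ha : a ∈ S) (hb : b ∈ S) (hab : a ≠ b) :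
    l (b - a) ≠ 0 := by
  intro h
  have hd : 0 < d := by
    rcases Nat.eq_zero_or_pos d with rfl | h
    · exact absurd (Subsingleton.elim a b) hab
    · exact h
  obtain ⟨hF, hker⟩ := isFacet_of_mem_extremePoints_polarSet hd hV hl
  refine hgp a ha b hb hab _ hF ⟨AffineSubspace.mk' a
    (vectorSpan ℝ {y ∈ convexHull ℝ V | l y = 1}), ?_,
    AffineSubspace.self_mem_mk' _ _, ?_⟩
  · rw [AffineSubspace.parallel_iff_direction_eq_and_eq_bot_iff_eq_bot]
    refine ⟨(AffineSubspace.direction_mk' _ _).trans (direction_affineSpan ℝ _).symm, ?_⟩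
    rw [affineSpan_eq_bot]
    refine ⟨fun h => ?_, fun h => absurd h hF.1.ne_empty⟩
    exact ((AffineSubspace.nonempty_iff_ne_bot _).mp
      ⟨a, AffineSubspace.self_mem_mk' _ _⟩ h).elim
  · rw [AffineSubspace.mem_mk', hker]
    exact h

end Facet

/-! ### Solving monotone equations -/

/-- If `φ p` is the point at which `G p` changes sign, and `G` is continuous in `p`, then `φ` is
continuous. -/
lemma continuousOn_of_sign_change {Y : Type*} [TopologicalSpace Y] {S : Set Y} {I : Set ℝ}
    (hI : I.OrdConnected) {G : Y → ℝ → ℝ} {φ : Y → ℝ} (hφ : MapsTo φ S I)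
    (hG : ∀ t ∈ I, ContinuousOn (fun p => G p t) S)
    (hlo : ∀ p ∈ S, ∀ t ∈ I, t < φ p ↔ G p t < 0)
    (hhi : ∀ p ∈ S, ∀ t ∈ I, φ p < t ↔ 0 < G p t) : ContinuousOn φ S := by
  intro p hp
  refine tendsto_order.2 ⟨fun t ht => ?_, fun t ht => ?_⟩
  · by_cases htI : t ∈ I
    · filter_upwards [(hG t htI p hp).eventually (gt_mem_nhds ((hlo p hp t htI).1 ht)),
        self_mem_nhdsWithin] with q hq hqS
      exact (hlo q hqS t htI).2 hq
    · filter_upwards [self_mem_nhdsWithin] with q hqS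
      by_contra h
      exact htI (hI.out (hφ hqS) (hφ hp) ⟨not_lt.1 h, ht.le⟩)
  · by_cases htI : t ∈ I
    · filter_upwards [(hG t htI p hp).eventually (lt_mem_nhds ((hhi p hp t htI).1 ht)),
        self_mem_nhdsWithin] with q hq hqS
      exact (hhi q hqS t htI).2 hq
    · filter_upwards [self_mem_nhdsWithin] with q hqS
      by_contra h
      exact htI (hI.out (hφ hp) (hφ hqS) ⟨ht.le, not_lt.1 h⟩)

/-- If `F` is increasing in both variables, then `F x t = 0` can be solved for `x` as a
continuous function of `t`. -/
lemma exists_continuousOn_solution {F : ℝ → ℝ → ℝ} (hF : Continuous fun p : ℝ × ℝ => F p.1 p.2)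
    {ε δ : ℝ} (hε : 0 < ε) (hmono : ∀ t ∈ Icc (-δ) δ, StrictMonoOn (F · t) (Icc (-ε) ε))
    (hmono' : ∀ x ∈ Icc (-ε) ε, MonotoneOn (F x) (Icc (-δ) δ)) (hδ : 0 < δ)
    (h1 : F (-ε) δ < 0) (h2 : 0 < F ε (-δ)) :
    ∃ φ : ℝ → ℝ, MapsTo φ (Icc (-δ) δ) (Icc (-ε) ε) ∧ ContinuousOn φ (Icc (-δ) δ) ∧
      ∀ t ∈ Icc (-δ) δ, F (φ t) t = 0 := by
  have hex : ∀ t, ∃ x, t ∈ Icc (-δ) δ → x ∈ Icc (-ε) ε ∧ F x t = 0 := by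
    intro t
    by_cases ht : t ∈ Icc (-δ) δ
    · have e1 : F (-ε) t ≤ 0 :=
        (hmono' (-ε) ⟨le_rfl, by linarith⟩ ht ⟨by linarith, le_rfl⟩ ht.2).trans h1.le
      have e2 : 0 ≤ F ε t :=
        h2.le.trans (hmono' ε ⟨by linarith, le_rfl⟩ ⟨le_rfl, by linarith⟩ ht ht.1)
      have hc : ContinuousOn (F · t) (Icc (-ε) ε) :=
        (hF.comp (by fun_prop : Continuous fun x : ℝ => (x, t))).continuousOn
      obtain ⟨x, hx, hx0⟩ := intermediate_value_Icc (by linarith) hc ⟨e1, e2⟩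
      exact ⟨x, fun _ => ⟨hx, hx0⟩⟩
    · exact ⟨0, fun h => absurd h ht⟩
  choose φ hφ using hex
  refine ⟨φ, fun t ht => (hφ t ht).1, ?_, fun t ht => (hφ t ht).2⟩
  refine continuousOn_of_sign_change (G := fun t x => F x t) ordConnected_Icc
    (fun t ht => (hφ t ht).1)
    (fun x _ => (hF.comp (by fun_prop : Continuous fun t : ℝ => (x, t))).continuousOn) ?_ ?_
  · intro t ht x hx
    obtain ⟨h3, h4⟩ := hφ t ht
    rw [← h4]
    exact ((hmono t ht).lt_iff_lt hx h3).symm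
  · intro t ht x hx
    obtain ⟨h3, h4⟩ := hφ t ht
    rw [← h4]
    exact ((hmono t ht).lt_iff_lt h3 hx).symm

/-- `F` is strictly increasing in both variables on the square of radius `ε`. -/
def StrictMonoOnSquare (F : ℝ → ℝ → ℝ) (ε : ℝ) : Prop :=
  ∀ t ∈ Icc (-ε) ε, StrictMonoOn (F · t) (Icc (-ε) ε) ∧ StrictMonoOn (F t) (Icc (-ε) ε)

/-- Three equations `F₁ (y, z) = F₂ (x, z) = F₃ (x, y) = 0` with increasing left-hand sides have a
common solution in a box as soon as certain strict inequalities hold. The first two are solved for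
`y` and `x` as decreasing functions of `z`; the third is then a monotone equation for `z`. -/
lemma exists_solution_of_strictMonoOnSquare {F₁ F₂ F₃ : ℝ → ℝ → ℝ}
    (hF₁ : Continuous fun p : ℝ × ℝ => F₁ p.1 p.2) (hF₂ : Continuous fun p : ℝ × ℝ => F₂ p.1 p.2)
    (hF₃ : Continuous fun p : ℝ × ℝ => F₃ p.1 p.2) {ε δ η : ℝ}
    (h₁ : StrictMonoOnSquare F₁ ε) (h₂ : StrictMonoOnSquare F₂ ε) (h₃ : StrictMonoOnSquare F₃ ε)
    (hδ : 0 < δ) (hδε : δ ≤ ε) (hη : 0 < η) (hηε : η ≤ ε)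
    (h₁₁ : F₁ (-ε) δ < 0) (h₁₂ : 0 < F₁ ε (-δ)) (h₁₃ : 0 < F₁ (-η) δ) (h₁₄ : F₁ η (-δ) < 0)
    (h₂₁ : F₂ (-ε) δ < 0) (h₂₂ : 0 < F₂ ε (-δ)) (h₂₃ : 0 < F₂ (-η) δ) (h₂₄ : F₂ η (-δ) < 0)
    (h₃₁ : F₃ (-η) (-η) < 0) (h₃₂ : 0 < F₃ η η) :
    ∃ x ∈ Icc (-ε) ε, ∃ y ∈ Icc (-ε) ε, ∃ z ∈ Icc (-ε) ε,
      F₁ y z = 0 ∧ F₂ x z = 0 ∧ F₃ x y = 0 := by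
  have hε : 0 < ε := hδ.trans_le hδε
  have hsub : Icc (-δ) δ ⊆ Icc (-ε) ε := Icc_subset_Icc (by linarith) hδε
  have hη1 : η ∈ Icc (-ε) ε := ⟨by linarith, hηε⟩
  have hη2 : -η ∈ Icc (-ε) ε := ⟨by linarith, by linarith⟩
  have hδ1 : δ ∈ Icc (-δ) δ := ⟨by linarith, le_rfl⟩
  have hδ2 : -δ ∈ Icc (-δ) δ := ⟨le_rfl, by linarith⟩
  have solve : ∀ F : ℝ → ℝ → ℝ, (Continuous fun p : ℝ × ℝ => F p.1 p.2) →
      StrictMonoOnSquare F ε → F (-ε) δ < 0 → 0 < F ε (-δ) → 0 < F (-η) δ → F η (-δ) < 0 →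
      ∃ φ : ℝ → ℝ, MapsTo φ (Icc (-δ) δ) (Icc (-ε) ε) ∧ ContinuousOn φ (Icc (-δ) δ) ∧
        (∀ t ∈ Icc (-δ) δ, F (φ t) t = 0) ∧ φ δ ≤ -η ∧ η ≤ φ (-δ) := by
    intro F hF hm e1 e2 e3 e4
    obtain ⟨φ, hφ1, hφ2, hφ3⟩ := exists_continuousOn_solution hF hε
      (fun t ht => (hm t (hsub ht)).1) (fun x hx => ((hm x hx).2.monotoneOn).mono hsub) hδ e1 e2
    refine ⟨φ, hφ1, hφ2, hφ3, ?_, ?_⟩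
    · refine (((hm δ (hsub hδ1)).1.lt_iff_lt (hφ1 hδ1) hη2).1 ?_).le
      simpa only [hφ3 δ hδ1] using e3
    · refine (((hm (-δ) (hsub hδ2)).1.lt_iff_lt hη1 (hφ1 hδ2)).1 ?_).le
      simpa only [hφ3 (-δ) hδ2] using e4
  obtain ⟨φ, hφm, hφc, hφ, hφ1, hφ2⟩ := solve F₁ hF₁ h₁ h₁₁ h₁₂ h₁₃ h₁₄
  obtain ⟨ψ, hψm, hψc, hψ, hψ1, hψ2⟩ := solve F₂ hF₂ h₂ h₂₁ h₂₂ h₂₃ h₂₄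
  have hmono : ∀ x ∈ Icc (-ε) ε, ∀ y ∈ Icc (-ε) ε, ∀ x' ∈ Icc (-ε) ε, ∀ y' ∈ Icc (-ε) ε,
      x ≤ x' → y ≤ y' → F₃ x y ≤ F₃ x' y' := fun x hx y hy x' hx' y' hy' hxx hyy =>
    ((h₃ y hy).1.monotoneOn hx hx' hxx).trans ((h₃ x' hx').2.monotoneOn hy hy' hyy)
  have hc : ContinuousOn (fun z => F₃ (ψ z) (φ z)) (Icc (-δ) δ) :=
    hF₃.comp_continuousOn (hψc.prodMk hφc)
  have e1 : F₃ (ψ δ) (φ δ) ≤ 0 :=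
    (hmono _ (hψm hδ1) _ (hφm hδ1) _ hη2 _ hη2 hψ1 hφ1).trans h₃₁.le
  have e2 : 0 ≤ F₃ (ψ (-δ)) (φ (-δ)) :=
    h₃₂.le.trans (hmono _ hη1 _ hη1 _ (hψm hδ2) _ (hφm hδ2) hψ2 hφ2)
  obtain ⟨z, hz, hz0⟩ := intermediate_value_Icc' (by linarith) hc ⟨e1, e2⟩
  exact ⟨ψ z, hψm hz, φ z, hφm hz, z, hsub hz, hφ z hz, hψ z hz, hz0⟩

/-- Implicit function theorem for a triple of monotone equations: a solution at the parameter
`u₀` persists, arbitrarily close to the original one, for the parameters close to `u₀`. -/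
lemma eventually_exists_solution {X : Type*} [TopologicalSpace X] {u₀ : X}
    {F₁ F₂ F₃ : X → ℝ → ℝ → ℝ}
    (hF₁ : Continuous fun p : X × ℝ × ℝ => F₁ p.1 p.2.1 p.2.2)
    (hF₂ : Continuous fun p : X × ℝ × ℝ => F₂ p.1 p.2.1 p.2.2)
    (hF₃ : Continuous fun p : X × ℝ × ℝ => F₃ p.1 p.2.1 p.2.2)
    (h₁ : F₁ u₀ 0 0 = 0) (h₂ : F₂ u₀ 0 0 = 0) (h₃ : F₃ u₀ 0 0 = 0) {ε : ℝ} (hε : 0 < ε)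
    (hm : ∀ᶠ u in 𝓝 u₀, StrictMonoOnSquare (F₁ u) ε ∧ StrictMonoOnSquare (F₂ u) ε ∧
      StrictMonoOnSquare (F₃ u) ε) :
    ∀ᶠ u in 𝓝 u₀, ∃ x ∈ Icc (-ε) ε, ∃ y ∈ Icc (-ε) ε, ∃ z ∈ Icc (-ε) ε,
      F₁ u y z = 0 ∧ F₂ u x z = 0 ∧ F₃ u x y = 0 := by
  obtain ⟨m₁, m₂, m₃⟩ := hm.self_of_nhds
  have i0 : (0 : ℝ) ∈ Icc (-ε) ε := ⟨by linarith, hε.le⟩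
  have iε : ε ∈ Icc (-ε) ε := ⟨by linarith, le_rfl⟩
  have iε' : -ε ∈ Icc (-ε) ε := ⟨le_rfl, by linarith⟩
  have cont : ∀ F : X → ℝ → ℝ → ℝ, (Continuous fun p : X × ℝ × ℝ => F p.1 p.2.1 p.2.2) →
      ∀ {Y : Type} [TopologicalSpace Y] (f g : Y → ℝ), Continuous f → Continuous g →
        Continuous fun t => F u₀ (f t) (g t) := fun F hF _ _ f g hf hg =>
    hF.comp (continuous_const.prodMk (hf.prodMk hg))
  -- `δ` is chosen so small that the solutions of the first two equations stay in the box.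
  have hδ : ∀ F : X → ℝ → ℝ → ℝ, (Continuous fun p : X × ℝ × ℝ => F p.1 p.2.1 p.2.2) →
      F u₀ 0 0 = 0 → StrictMonoOnSquare (F u₀) ε →
      ∀ᶠ δ : ℝ in 𝓝[>] 0, F u₀ (-ε) δ < 0 ∧ 0 < F u₀ ε (-δ) := by
    intro F hF h0 hm
    have e1 : F u₀ (-ε) 0 < 0 := ((hm 0 i0).1 iε' i0 (by linarith)).trans_eq h0
    have e2 : 0 < F u₀ ε (-0) := by
      rw [neg_zero]
      exact h0.symm.trans_lt ((hm 0 i0).1 i0 iε hε)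
    exact (((cont F hF (fun _ => -ε) id (by fun_prop) (by fun_prop)).tendsto 0).eventually
      (gt_mem_nhds e1)).and (((cont F hF (fun _ => ε) (fun t => -t) (by fun_prop)
        (by fun_prop)).tendsto 0).eventually (lt_mem_nhds e2)) |>.filter_mono nhdsWithin_le_nhds
  obtain ⟨δ, ⟨⟨d₁₁, d₁₂⟩, d₂₁, d₂₂⟩, hδ0, hδε⟩ := (((hδ F₁ hF₁ h₁ m₁).and (hδ F₂ hF₂ h₂ m₂)).and
    (Ioo_mem_nhdsGT hε)).exists
  have iδ : δ ∈ Icc (-ε) ε := ⟨by linarith, hδε.le⟩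
  have iδ' : -δ ∈ Icc (-ε) ε := ⟨by linarith, by linarith⟩
  -- `η` bounds from below how far these solutions move when the third unknown is `±δ`; this makes
  -- the sign of the third equation at `±δ` stable under perturbation of the parameter.
  have hη : ∀ F : X → ℝ → ℝ → ℝ, (Continuous fun p : X × ℝ × ℝ => F p.1 p.2.1 p.2.2) →
      F u₀ 0 0 = 0 → StrictMonoOnSquare (F u₀) ε →
      ∀ᶠ η : ℝ in 𝓝[>] 0, 0 < F u₀ (-η) δ ∧ F u₀ η (-δ) < 0 := by
    intro F hF h0 hm
    have e1 : 0 < F u₀ (-0) δ := by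
      rw [neg_zero]
      exact h0.symm.trans_lt ((hm 0 i0).2 i0 iδ hδ0)
    have e2 : F u₀ 0 (-δ) < 0 := ((hm 0 i0).2 iδ' i0 (by linarith)).trans_eq h0
    exact (((cont F hF (fun t => -t) (fun _ => δ) (by fun_prop) (by fun_prop)).tendsto 0).eventually
      (lt_mem_nhds e1)).and (((cont F hF id (fun _ => -δ) (by fun_prop)
        (by fun_prop)).tendsto 0).eventually (gt_mem_nhds e2)) |>.filter_mono nhdsWithin_le_nhds
  obtain ⟨η, ⟨⟨e₁₁, e₁₂⟩, e₂₁, e₂₂⟩, hη0, hηε⟩ := (((hη F₁ hF₁ h₁ m₁).and (hη F₂ hF₂ h₂ m₂)).and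
    (Ioo_mem_nhdsGT hε)).exists
  have iη : η ∈ Icc (-ε) ε := ⟨by linarith, hηε.le⟩
  have iη' : -η ∈ Icc (-ε) ε := ⟨by linarith, by linarith⟩
  have f₁ : F₃ u₀ (-η) (-η) < 0 :=
    h₃ ▸ ((m₃ _ iη').1 iη' i0 (by linarith)).trans ((m₃ 0 i0).2 iη' i0 (by linarith))
  have f₂ : 0 < F₃ u₀ η η :=
    h₃ ▸ ((m₃ 0 i0).1 i0 iη hη0).trans ((m₃ η iη).2 i0 iη hη0)
  have lt : ∀ F : X → ℝ → ℝ → ℝ, (Continuous fun p : X × ℝ × ℝ => F p.1 p.2.1 p.2.2) →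
      ∀ s t, F u₀ s t < 0 → ∀ᶠ u in 𝓝 u₀, F u s t < 0 := fun F hF s t h =>
    ((hF.comp (by fun_prop : Continuous fun u : X => (u, s, t))).tendsto u₀).eventually
      (gt_mem_nhds h)
  have gt : ∀ F : X → ℝ → ℝ → ℝ, (Continuous fun p : X × ℝ × ℝ => F p.1 p.2.1 p.2.2) →
      ∀ s t, 0 < F u₀ s t → ∀ᶠ u in 𝓝 u₀, 0 < F u s t := fun F hF s t h =>
    ((hF.comp (by fun_prop : Continuous fun u : X => (u, s, t))).tendsto u₀).eventually
      (lt_mem_nhds h)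
  have sec : ∀ {F : X → ℝ → ℝ → ℝ}, (Continuous fun p : X × ℝ × ℝ => F p.1 p.2.1 p.2.2) →
      ∀ u, Continuous fun p : ℝ × ℝ => F u p.1 p.2 := fun hF u =>
    hF.comp (by fun_prop : Continuous fun p : ℝ × ℝ => (u, p.1, p.2))
  filter_upwards [hm, lt F₁ hF₁ _ _ d₁₁, gt F₁ hF₁ _ _ d₁₂, gt F₁ hF₁ _ _ e₁₁, lt F₁ hF₁ _ _ e₁₂,
    lt F₂ hF₂ _ _ d₂₁, gt F₂ hF₂ _ _ d₂₂, gt F₂ hF₂ _ _ e₂₁, lt F₂ hF₂ _ _ e₂₂,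
    lt F₃ hF₃ _ _ f₁, gt F₃ hF₃ _ _ f₂] with u ⟨k₁, k₂, k₃⟩ a1 a2 a3 a4 b1 b2 b3 b4 c1 c2
  exact exists_solution_of_strictMonoOnSquare (sec hF₁ u) (sec hF₂ u) (sec hF₃ u) k₁ k₂ k₃
    hδ0 hδε.le hη0 hηε.le a1 a2 a3 a4 b1 b2 b3 b4 c1 c2

/-! ### Monotonicity of maxima of linear functionals -/

section IsMaxOf

variable {E : Type*} [NormedAddCommGroup E] [NormedSpace ℝ E] {g : E → ℝ} {N : Set (E →L[ℝ] ℝ)}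

/-- The functionals of `N` that attain the maximum `g` at `y` are positive on `v`. -/
def ActivePos (g : E → ℝ) (N : Set (E →L[ℝ] ℝ)) (y v : E) : Prop :=
  ∀ n ∈ N, n y = g y → 0 < n v

lemma IsMaxOf.eventually_lt_add_smul (hgN : IsMaxOf g N) (hg : Continuous g) {y v : E}
    (h : ActivePos g N y v) : ∀ᶠ z in 𝓝 y, ∀ t : ℝ, 0 < t → g z < g (z + t • v) := by
  have : ∀ n ∈ N, ∀ᶠ z in 𝓝 y, n z = g z → n y = g y := by
    intro n hn
    rcases (hgN.le n hn y).eq_or_lt with h | h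
    · exact Eventually.of_forall fun _ _ => h
    · filter_upwards [(isOpen_lt n.continuous hg).mem_nhds h] with z hz e
      exact absurd e (ne_of_lt hz)
  filter_upwards [hgN.finite.eventually_all.mpr this] with z hz t ht
  obtain ⟨n, hn, hnz⟩ := hgN.exists_eq z
  have h1 := hgN.le n hn (z + t • v)
  have h2 := mul_pos ht (h n hn (hz n hn hnz))
  rw [map_add, map_smul, smul_eq_mul, hnz] at h1
  linarith

/-- The sections of `g` in a plane through `y` spanned by two directions on which all active
functionals are positive are strictly increasing, locally uniformly in `y`. -/
lemma IsMaxOf.exists_strictMonoOnSquare (hgN : IsMaxOf g N) (hg : Continuous g) {y v w : E}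
    (hv : ActivePos g N y v) (hw : ActivePos g N y w) :
    ∃ ε₀ > 0, ∀ᶠ z in 𝓝 y, ∀ ε ≤ ε₀,
      StrictMonoOnSquare (fun s t : ℝ => g (z + s • v + t • w) - 1) ε := by
  have hc : Tendsto (fun p : E × ℝ × ℝ => p.1 + p.2.1 • v + p.2.2 • w) (𝓝 (y, 0, 0)) (𝓝 y) := by
    have : Continuous fun p : E × ℝ × ℝ => p.1 + p.2.1 • v + p.2.2 • w := by fun_prop
    simpa using this.tendsto (y, 0, 0)
  have h := hc.eventually ((hgN.eventually_lt_add_smul hg hv).and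
    (hgN.eventually_lt_add_smul hg hw))
  rw [nhds_prod_eq, eventually_prod_iff] at h
  obtain ⟨p, hp, q, hq, hpq⟩ := h
  obtain ⟨r, hr, hrq⟩ := Metric.mem_nhds_iff.mp hq
  refine ⟨r / 2, by positivity, ?_⟩
  filter_upwards [hp] with z hz ε hε
  have hin : ∀ s ∈ Icc (-ε) ε, ∀ t ∈ Icc (-ε) ε, q (s, t) := by
    intro s hs t ht
    refine hrq ?_
    have h1 : |s| < r := abs_lt.mpr ⟨by linarith [hs.1], by linarith [hs.2]⟩
    have h2 : |t| < r := abs_lt.mpr ⟨by linarith [ht.1], by linarith [ht.2]⟩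
    rw [← Prod.zero_eq_mk, mem_ball_zero_iff]
    exact max_lt h1 h2
  refine fun t ht => ⟨fun s hs s' hs' hlt => ?_, fun s hs s' hs' hlt => ?_⟩
  · have := (hpq hz (hin s hs t ht)).1 (s' - s) (by linarith)
    have e : z + s • v + t • w + (s' - s) • v = z + s' • v + t • w := by module
    simp only [e] at this
    simpa using this
  · have := (hpq hz (hin t ht s hs)).2 (s' - s) (by linarith)
    have e : z + t • v + s • w + (s' - s) • w = z + t • v + s' • w := by module
    simp only [e] at this
    simpa using this

/-- Two points on a level set of `g`, at both of which all active functionals are positive on `v`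
and `w`, differ by a combination of `v` and `w` with coefficients of opposite signs. -/
lemma IsMaxOf.mul_neg_of_eq_add (hgN : IsMaxOf g N) {y y' v w : E} {s t : ℝ}
    (he : g y = g y') (hy : y' = y + s • v + t • w)
    (hv : ActivePos g N y v) (hw : ActivePos g N y w)
    (hv' : ActivePos g N y' v) (hw' : ActivePos g N y' w) : (s = 0 ∧ t = 0) ∨ s * t < 0 := by
  obtain ⟨n, hn, hny⟩ := hgN.exists_eq y
  obtain ⟨m, hm, hmy⟩ := hgN.exists_eq y'
  have h1 : s * n v + t * n w ≤ 0 := by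
    have := hgN.le n hn y'
    rw [hy, map_add, map_add, map_smul, map_smul, smul_eq_mul, smul_eq_mul, ← hy, hny] at this
    linarith
  have h2 : 0 ≤ s * m v + t * m w := by
    have := hgN.le m hm y
    have h3 : m y' = m y + s * m v + t * m w := by
      rw [hy, map_add, map_add, map_smul, map_smul, smul_eq_mul, smul_eq_mul]
    linarith
  have pv := hv n hn hny
  have pw := hw n hn hny
  have qv := hv' m hm hmy
  have qw := hw' m hm hmy
  rcases lt_trichotomy s 0 with hs | hs | hs <;> rcases lt_trichotomy t 0 with ht | ht | ht
  · nlinarith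
  · subst ht; nlinarith
  · exact Or.inr (mul_neg_of_neg_of_pos hs ht)
  · subst hs; nlinarith
  · exact Or.inl ⟨hs, ht⟩
  · subst hs; nlinarith
  · exact Or.inr (mul_neg_of_pos_of_neg hs ht)
  · subst ht; nlinarith
  · nlinarith

end IsMaxOf

/-- No three real numbers have pairwise strictly opposite signs. -/
lemma eq_zero_of_pairwise_mul_neg {x y z : ℝ} (h₁ : (y = 0 ∧ z = 0) ∨ y * z < 0)
    (h₂ : (x = 0 ∧ z = 0) ∨ x * z < 0) (h₃ : (x = 0 ∧ y = 0) ∨ x * y < 0) :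
    x = 0 ∧ y = 0 ∧ z = 0 := by
  rcases h₁ with ⟨hy, hz⟩ | h₁
  · rcases h₂ with ⟨hx, -⟩ | h₂
    · exact ⟨hx, hy, hz⟩
    · simp [hz] at h₂
  · have hz := right_ne_zero_of_mul h₁.ne
    have h₂' : x * z < 0 := h₂.resolve_left fun h => hz h.2
    have h₃' : x * y < 0 := h₃.resolve_left fun h => left_ne_zero_of_mul h₁.ne h.2
    nlinarith [mul_pos_of_neg_of_neg h₁ h₂', mul_self_pos.mpr hz]

/-! ### Bisectors of two sites -/

section TwoSites

variable {E : Type*} [NormedAddCommGroup E] [NormedSpace ℝ E] {g : E → ℝ} {N : Set (E →L[ℝ] ℝ)}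

/-- No functional of `N` takes the same value at `a` and `b`. -/
def Separates (N : Set (E →L[ℝ] ℝ)) (a b : E) : Prop :=
  ∀ n ∈ N, n (b - a) ≠ 0

lemma Separates.symm {a b : E} (h : Separates N a b) : Separates N b a := by
  intro n hn e
  rw [← neg_sub, map_neg, neg_eq_zero] at e
  exact h n hn e

lemma IsMaxOf.smul (hgN : IsMaxOf g N) {t : ℝ} (ht : 0 ≤ t) (y : E) : g (t • y) = t * g y := by
  refine le_antisymm ?_ ?_
  · obtain ⟨n, hn, h⟩ := hgN.exists_eq (t • y)
    rw [← h, map_smul, smul_eq_mul]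
    exact mul_le_mul_of_nonneg_left (hgN.le n hn y) ht
  · obtain ⟨n, hn, h⟩ := hgN.exists_eq y
    have := hgN.le n hn (t • y)
    rwa [map_smul, smul_eq_mul, h] at this

/-- Moving a point of the bisector of `y` and `y - v` in direction `v` makes the second distance
the smaller one. -/
lemma IsMaxOf.lt_of_eq_sub (hgN : IsMaxOf g N) {y v : E} (hv : ∀ n ∈ N, n v ≠ 0)
    (he : g y = g (y - v)) {s : ℝ} (hs : 0 < s) : g (y - v + s • v) < g (y + s • v) := by
  obtain ⟨n, hn, hnz⟩ := hgN.exists_eq (y - v + s • v)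
  rcases (hv n hn).lt_or_gt with h | h
  · obtain ⟨m, hm, hmy⟩ := hgN.exists_eq y
    have h1 : 0 < m v := by
      refine lt_of_le_of_ne ?_ (hv m hm).symm
      have := hgN.le m hm (y - v)
      rw [map_sub] at this
      linarith
    have h2 := hgN.le m hm (y + s • v)
    have h3 := hgN.le n hn (y - v)
    rw [map_add, map_smul, smul_eq_mul] at h2 hnz
    nlinarith [mul_pos hs h1, mul_neg_of_pos_of_neg hs h]
  · have h1 := hgN.le n hn (y + s • v)
    have e : y + s • v = (y - v + s • v) + v := by module
    rw [e, map_add] at h1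
    rw [e]
    linarith

lemma IsMaxOf.exists_lt_add (hgN : IsMaxOf g N) {v : E} (hv : ∀ n ∈ N, n v ≠ 0) (hgv : 0 < g v)
    (y : E) : ∃ t : ℝ, g (y + t • v) < g (y + t • v + v) := by
  set t := (g y + g (-y)) / g v + 1 with ht
  have ht' : t * g v = g y + g (-y) + g v := by
    rw [ht]; field_simp
  refine ⟨t, ?_⟩
  obtain ⟨n, hn, hnz⟩ := hgN.exists_eq (y + t • v)
  obtain ⟨m, hm, hmv⟩ := hgN.exists_eq v
  have h1 := hgN.le m hm (y + t • v)
  have h2 := hgN.le m hm (-y)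
  have h3 := hgN.le n hn y
  have h4 := hgN.le n hn (-y)
  have h5 := hgN.le n hn (y + t • v + v)
  have ht0 : 0 < t := by
    rw [map_neg] at h4
    have : 0 ≤ g y + g (-y) := by linarith
    positivity
  rw [map_add, map_smul, smul_eq_mul, hmv] at h1
  rw [map_neg] at h2
  rw [map_add _ (y + t • v), hnz] at h5
  rw [map_add, map_smul, smul_eq_mul] at hnz
  rcases (hv n hn).lt_or_gt with h | h
  · nlinarith [mul_neg_of_pos_of_neg ht0 h]
  · linarith

/-- The bisector of two separated sites is connected: each line parallel to `b - a`
meets it in exactly one point, which depends continuously on the line. -/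
lemma IsMaxOf.isPreconnected_bisector (hgN : IsMaxOf g N) (hg : Continuous g)
    (hpos : ∀ y, y ≠ 0 → 0 < g y) {a b : E} (hab : a ≠ b) (hsep : Separates N a b) :
    IsPreconnected {x | g (x - a) = g (x - b)} := by
  set v := b - a with hvdef
  set G : E → ℝ → ℝ := fun x t => g (x + t • v - a) - g (x + t • v - b) with hG
  have hv0 : v ≠ 0 := sub_ne_zero.mpr hab.symm
  have hsep' : ∀ n ∈ N, n (-v) ≠ 0 := fun n hn h => hsep n hn (by rwa [map_neg, neg_eq_zero] at h)
  have hex : ∀ x, ∃ t, G x t = 0 := by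
    intro x
    have hc : Continuous (G x) := by simp only [hG]; fun_prop
    refine mem_range_of_exists_le_of_exists_ge hc ?_ ?_
    · obtain ⟨t, ht⟩ := hgN.exists_lt_add hsep' (hpos _ (neg_ne_zero.mpr hv0)) (x - a)
      refine ⟨-t, ?_⟩
      have e1 : x - a + t • -v = x + (-t) • v - a := by module
      have e2 : x - a + t • -v + -v = x + (-t) • v - b := by rw [hvdef]; module
      rw [e2, e1] at ht
      exact (sub_neg.mpr ht).le
    · obtain ⟨t, ht⟩ := hgN.exists_lt_add hsep (hpos _ hv0) (x - b)
      refine ⟨t, ?_⟩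
      have e1 : x - b + t • v = x + t • v - b := by module
      have e2 : x - b + t • v + v = x + t • v - a := by rw [hvdef]; module
      rw [e2, e1] at ht
      exact (sub_pos.mpr ht).le
  choose τ hτ using hex
  have hhi : ∀ x t, τ x < t → 0 < G x t := by
    intro x t ht
    have e : x + τ x • v - a - v = x + τ x • v - b := by rw [hvdef]; module
    have := hgN.lt_of_eq_sub (y := x + τ x • v - a) hsep (by rw [e]; exact sub_eq_zero.mp (hτ x))
      (sub_pos.mpr ht)
    have e1 : x + τ x • v - a - v + (t - τ x) • v = x + t • v - b := by rw [hvdef]; module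
    have e2 : x + τ x • v - a + (t - τ x) • v = x + t • v - a := by module
    rw [e1, e2] at this
    exact sub_pos.mpr this
  have hlo : ∀ x t, t < τ x → G x t < 0 := by
    intro x t ht
    have e : x + τ x • v - b - -v = x + τ x • v - a := by rw [hvdef]; module
    have := hgN.lt_of_eq_sub (y := x + τ x • v - b) (v := -v) hsep'
      (by rw [e]; exact (sub_eq_zero.mp (hτ x)).symm) (sub_pos.mpr ht)
    have e1 : x + τ x • v - b - -v + (τ x - t) • -v = x + t • v - a := by rw [hvdef]; module
    have e2 : x + τ x • v - b + (τ x - t) • -v = x + t • v - b := by module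
    rw [e1, e2] at this
    exact sub_neg.mpr this
  have hτc : Continuous τ := by
    rw [← continuousOn_univ]
    refine continuousOn_of_sign_change (I := univ) (G := G) ordConnected_univ (mapsTo_univ _ _)
      (fun t _ => ?_) ?_ ?_
    · have : Continuous fun x => G x t := by simp only [hG]; fun_prop
      exact this.continuousOn
    · refine fun x _ t _ => ⟨hlo x t, fun h => ?_⟩
      by_contra h'
      rcases (not_lt.mp h').eq_or_lt with h' | h'
      · exact absurd (h' ▸ hτ x) h.ne
      · exact absurd (hhi x t h') h.not_gt
    · refine fun x _ t _ => ⟨hhi x t, fun h => ?_⟩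
      by_contra h'
      rcases (not_lt.mp h').eq_or_lt with h' | h'
      · exact absurd (h' ▸ hτ x) h.ne'
      · exact absurd (hlo x t h') h.not_gt
  have hrange : {x | g (x - a) = g (x - b)} = range fun x => x + τ x • v := by
    ext x
    refine ⟨fun hx => ⟨x, ?_⟩, ?_⟩
    · have hx0 : G x 0 = 0 := by simpa [hG] using sub_eq_zero.mpr hx
      have : τ x = 0 := by
        by_contra h
        rcases lt_or_gt_of_ne h with h | h
        · exact absurd hx0 (hhi x 0 h).ne'
        · exact absurd hx0 (hlo x 0 h).ne
      simp [this]
    · rintro ⟨z, rfl⟩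
      exact sub_eq_zero.mp (hτ z)
  rw [hrange]
  exact isPreconnected_range (by fun_prop)

end TwoSites

/-! ### Existence of a point equidistant from three sites -/

section Existence

/-- If `f₁` and `f₂` are each somewhere the smallest of the three, then at some point `f₁` is the
smallest together with `f₂` or together with `f₃`. -/
lemma exists_eq_and_le {X : Type*} [TopologicalSpace X] [PreconnectedSpace X] {f₁ f₂ f₃ : X → ℝ}
    (h₁ : Continuous f₁) (h₂ : Continuous f₂) (h₃ : Continuous f₃)
    (m₁ : ∃ x, f₁ x ≤ f₂ x ∧ f₁ x ≤ f₃ x) (m₂ : ∃ x, f₂ x ≤ f₁ x ∧ f₂ x ≤ f₃ x) :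
    (∃ x, f₁ x = f₂ x ∧ f₁ x ≤ f₃ x) ∨ ∃ x, f₁ x = f₃ x ∧ f₁ x ≤ f₂ x := by
  obtain ⟨x, hx⟩ := m₁
  obtain ⟨y, hy⟩ := m₂
  obtain ⟨z, hz⟩ := mem_range_of_exists_le_of_exists_ge (c := (0 : ℝ)) (h₁.sub (h₂.min h₃))
    ⟨x, sub_nonpos.mpr (le_min hx.1 hx.2)⟩ ⟨y, sub_nonneg.mpr ((min_le_left _ _).trans hy.1)⟩
  have hz' : f₁ z = min (f₂ z) (f₃ z) := sub_eq_zero.mp hz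
  rcases le_total (f₂ z) (f₃ z) with h | h
  · rw [min_eq_left h] at hz'
    exact Or.inl ⟨z, hz', hz' ▸ h⟩
  · rw [min_eq_right h] at hz'
    exact Or.inr ⟨z, hz', hz' ▸ h⟩

lemma IsPreconnected.exists_eq_of_le {X : Type*} [TopologicalSpace X] {f h : X → ℝ} {S : Set X}
    (hS : IsPreconnected S) (hf : Continuous f) (hh : Continuous h) (h₁ : ∃ x ∈ S, f x ≤ h x)
    (h₂ : ∃ x ∈ S, h x ≤ f x) : ∃ x ∈ S, f x = h x := by
  obtain ⟨x, hx, hx'⟩ := h₁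
  obtain ⟨y, hy, hy'⟩ := h₂
  exact hS.intermediate_value₂ hx hy hf.continuousOn hh.continuousOn hx' hy'

/-- Three continuous functions on a connected space, each of which is somewhere the smallest and
somewhere the largest, and any two of which agree on a connected set, agree at a common point.
Some pair agrees both at a point where it is the smallest and at a point where it is the largest,
since at most one pair fails to do the former and at most one pair fails to do the latter. -/
lemma exists_eq_of_isPreconnected {X : Type*} [TopologicalSpace X] [PreconnectedSpace X]
    {f₁ f₂ f₃ : X → ℝ} (h₁ : Continuous f₁) (h₂ : Continuous f₂) (h₃ : Continuous f₃)
    (c₁₂ : IsPreconnected {x | f₁ x = f₂ x}) (c₁₃ : IsPreconnected {x | f₁ x = f₃ x})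
    (c₂₃ : IsPreconnected {x | f₂ x = f₃ x})
    (m₁ : ∃ x, f₁ x ≤ f₂ x ∧ f₁ x ≤ f₃ x) (m₂ : ∃ x, f₂ x ≤ f₁ x ∧ f₂ x ≤ f₃ x)
    (m₃ : ∃ x, f₃ x ≤ f₁ x ∧ f₃ x ≤ f₂ x)
    (M₁ : ∃ x, f₂ x ≤ f₁ x ∧ f₃ x ≤ f₁ x) (M₂ : ∃ x, f₁ x ≤ f₂ x ∧ f₃ x ≤ f₂ x)
    (M₃ : ∃ x, f₁ x ≤ f₃ x ∧ f₂ x ≤ f₃ x) : ∃ x, f₁ x = f₂ x ∧ f₁ x = f₃ x := by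
  have swap : ∀ {p q : X → Prop}, (∃ x, p x ∧ q x) → ∃ x, q x ∧ p x :=
    fun ⟨x, h, h'⟩ => ⟨x, h', h⟩
  have key : ∀ {f₁ f₂ f₃ : X → ℝ}, Continuous f₁ → Continuous f₂ → Continuous f₃ →
      (∃ x, f₁ x ≤ f₂ x ∧ f₁ x ≤ f₃ x) → (∃ x, f₂ x ≤ f₁ x ∧ f₂ x ≤ f₃ x) →
      (∃ x, f₃ x ≤ f₁ x ∧ f₃ x ≤ f₂ x) →
      ((∃ x, f₁ x = f₂ x ∧ f₁ x ≤ f₃ x) ∨ ∃ x, f₁ x = f₃ x ∧ f₁ x ≤ f₂ x) ∧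
      ((∃ x, f₁ x = f₂ x ∧ f₁ x ≤ f₃ x) ∨ ∃ x, f₂ x = f₃ x ∧ f₂ x ≤ f₁ x) ∧
      ((∃ x, f₁ x = f₃ x ∧ f₁ x ≤ f₂ x) ∨ ∃ x, f₂ x = f₃ x ∧ f₂ x ≤ f₁ x) := by
    intro f₁ f₂ f₃ h₁ h₂ h₃ m₁ m₂ m₃
    refine ⟨exists_eq_and_le h₁ h₂ h₃ m₁ m₂, ?_, ?_⟩
    · refine (exists_eq_and_le h₂ h₁ h₃ m₂ m₁).imp_left ?_
      rintro ⟨x, hx, hx'⟩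
      exact ⟨x, hx.symm, hx ▸ hx'⟩
    · refine (exists_eq_and_le h₃ h₁ h₂ m₃ (swap m₁)).imp ?_ ?_
      · rintro ⟨x, hx, hx'⟩
        exact ⟨x, hx.symm, hx ▸ hx'⟩
      · rintro ⟨x, hx, hx'⟩
        exact ⟨x, hx.symm, hx ▸ hx'⟩
  obtain ⟨p₁, p₂, p₃⟩ := key h₁ h₂ h₃ m₁ m₂ m₃
  obtain ⟨q₁, q₂, q₃⟩ := key h₁.neg h₂.neg h₃.neg (by simpa using M₁) (by simpa using M₂)
    (by simpa using M₃)
  simp only [Pi.neg_apply, neg_inj, neg_le_neg_iff] at q₁ q₂ q₃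
  have common : ∀ P Q R P' Q' R' : Prop, (P ∨ Q) → (P ∨ R) → (Q ∨ R) → (P' ∨ Q') → (P' ∨ R') →
      (Q' ∨ R') → (P ∧ P') ∨ (Q ∧ Q') ∨ (R ∧ R') := by grind
  rcases common _ _ _ _ _ _ p₁ p₂ p₃ q₁ q₂ q₃ with ⟨l, u⟩ | ⟨l, u⟩ | ⟨l, u⟩
  · obtain ⟨x, hx, hx'⟩ := IsPreconnected.exists_eq_of_le c₁₂ h₁ h₃ l u
    exact ⟨x, hx, hx'⟩
  · obtain ⟨x, hx, hx'⟩ := IsPreconnected.exists_eq_of_le c₁₃ h₁ h₂ l u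
    exact ⟨x, hx', hx⟩
  · obtain ⟨x, hx, hx'⟩ := IsPreconnected.exists_eq_of_le c₂₃ h₂ h₁ l u
    exact ⟨x, hx'.symm, hx'.symm.trans hx⟩

variable {E : Type*} [NormedAddCommGroup E] [NormedSpace ℝ E] {g : E → ℝ} {N : Set (E →L[ℝ] ℝ)}

/-- If all active functionals at `y` are positive on `b - a` and `c - a`, then the points far away
from `a` in direction `y` are farther from `a` than from `b` and `c`. -/
lemma IsMaxOf.exists_farthest (hgN : IsMaxOf g N) (hg : Continuous g) {a b c y : E}
    (hb : ActivePos g N y (b - a)) (hc : ActivePos g N y (c - a)) :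
    ∃ x, g (x - b) ≤ g (x - a) ∧ g (x - c) ≤ g (x - a) := by
  have key : ∀ v, ActivePos g N y v → ∀ᶠ ε : ℝ in 𝓝[>] 0, g (y - ε • v) ≤ g y := by
    intro v hv
    have ht : Tendsto (fun ε : ℝ => y - ε • v) (𝓝[>] 0) (𝓝 y) := by
      have : Tendsto (fun ε : ℝ => y - ε • v) (𝓝 0) (𝓝 (y - (0 : ℝ) • v)) :=
        (by fun_prop : Continuous fun ε : ℝ => y - ε • v).tendsto 0
      simpa using this.mono_left nhdsWithin_le_nhds
    filter_upwards [ht.eventually (hgN.eventually_lt_add_smul hg hv), self_mem_nhdsWithin]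
      with ε hε hpos
    simpa using (hε ε hpos).le
  obtain ⟨ε, ⟨h1, h2⟩, hε⟩ := (((key _ hb).and (key _ hc)).and
    (self_mem_nhdsWithin (s := Ioi (0 : ℝ)))).exists
  have hε' : ε ≠ 0 := ne_of_gt hε
  have hi : 0 ≤ ε⁻¹ := inv_nonneg.mpr (le_of_lt hε)
  have e : ∀ b, a + ε⁻¹ • y - b = ε⁻¹ • (y - ε • (b - a)) := by
    intro b
    rw [smul_sub, smul_smul, inv_mul_cancel₀ hε']
    module
  refine ⟨a + ε⁻¹ • y, ?_, ?_⟩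
  · rw [e b, add_sub_cancel_left, hgN.smul hi, hgN.smul hi]
    exact mul_le_mul_of_nonneg_left h1 hi
  · rw [e c, add_sub_cancel_left, hgN.smul hi, hgN.smul hi]
    exact mul_le_mul_of_nonneg_left h2 hi

end Existence

/-! ### The bisector of three sites -/

section ThreeSites

variable {E : Type*} [NormedAddCommGroup E] [NormedSpace ℝ E] {g : E → ℝ} {N : Set (E →L[ℝ] ℝ)}

/-- At a point of the bisector of `a` and `b`, the active functionals seen from `a` are positive
on `b - a`. -/
lemma IsMaxOf.activePos_smul_sub (hgN : IsMaxOf g N) {a b x : E} (hsep : Separates N a b)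
    (he : g (x - a) = g (x - b)) {r : ℝ} (hr : 0 < r) : ActivePos g N (r • (x - a)) (b - a) := by
  intro n hn h
  rw [hgN.smul hr.le, map_smul, smul_eq_mul] at h
  have h1 : n (x - a) = g (x - a) := mul_left_cancel₀ hr.ne' h
  have h2 := hgN.le n hn (x - b)
  have h3 : n (b - a) = n (x - a) - n (x - b) := by
    rw [← map_sub]; congr 1; abel
  exact lt_of_le_of_ne (by linarith) (hsep n hn).symm

/-- Coordinates `γ` of a displacement that keeps three points `yᵢ` on their level sets of `g` vanish,
where `vᵢⱼ` is the velocity of `yᵢ` in the coordinate `γⱼ` and `yᵢ` does not depend on `γᵢ`. -/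
lemma IsMaxOf.coeff_eq_zero (hgN : IsMaxOf g N) {v₁₂ v₁₃ v₂₁ v₂₃ v₃₁ v₃₂ y₁ y₂ y₃ z₁ z₂ z₃ : E}
    {γ₁ γ₂ γ₃ : ℝ} (e₁ : z₁ = y₁ + γ₂ • v₁₂ + γ₃ • v₁₃) (e₂ : z₂ = y₂ + γ₁ • v₂₁ + γ₃ • v₂₃)
    (e₃ : z₃ = y₃ + γ₁ • v₃₁ + γ₂ • v₃₂) (g₁ : g y₁ = g z₁) (g₂ : g y₂ = g z₂) (g₃ : g y₃ = g z₃)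
    (hy₁ : ActivePos g N y₁ v₁₂ ∧ ActivePos g N y₁ v₁₃)
    (hy₂ : ActivePos g N y₂ v₂₁ ∧ ActivePos g N y₂ v₂₃)
    (hy₃ : ActivePos g N y₃ v₃₁ ∧ ActivePos g N y₃ v₃₂)
    (hz₁ : ActivePos g N z₁ v₁₂ ∧ ActivePos g N z₁ v₁₃)
    (hz₂ : ActivePos g N z₂ v₂₁ ∧ ActivePos g N z₂ v₂₃)
    (hz₃ : ActivePos g N z₃ v₃₁ ∧ ActivePos g N z₃ v₃₂) : γ₁ = 0 ∧ γ₂ = 0 ∧ γ₃ = 0 :=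
  eq_zero_of_pairwise_mul_neg (hgN.mul_neg_of_eq_add g₁ e₁ hy₁.1 hy₁.2 hz₁.1 hz₁.2)
    (hgN.mul_neg_of_eq_add g₂ e₂ hy₂.1 hy₂.2 hz₂.1 hz₂.2)
    (hgN.mul_neg_of_eq_add g₃ e₃ hy₃.1 hy₃.2 hz₃.1 hz₃.2)

/-- The vectors `a₂ - a₁` and `a₃ - a₁` are linearly independent if each of the three sites has a
point at which all active functionals are smallest on that site. -/
lemma IsMaxOf.linearIndependent (hgN : IsMaxOf g N) {a₁ a₂ a₃ y₁ y₂ y₃ : E}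
    (h₁ : ActivePos g N y₁ (a₂ - a₁) ∧ ActivePos g N y₁ (a₃ - a₁))
    (h₂ : ActivePos g N y₂ (a₁ - a₂) ∧ ActivePos g N y₂ (a₃ - a₂))
    (h₃ : ActivePos g N y₃ (a₁ - a₃) ∧ ActivePos g N y₃ (a₂ - a₃)) :
    LinearIndependent ℝ ![a₂ - a₁, a₃ - a₁] := by
  rw [LinearIndependent.pair_iff]
  intro s t h
  refine (hgN.coeff_eq_zero (γ₁ := -s - t) (γ₂ := s) (γ₃ := t) ?_ ?_ ?_ rfl rfl rfl
    h₁ h₂ h₃ h₁ h₂ h₃).2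
  · rw [add_assoc, h, add_zero]
  · have : y₂ + (-s - t) • (a₁ - a₂) + t • (a₃ - a₂) = y₂ + (s • (a₂ - a₁) + t • (a₃ - a₁)) := by
      module
    rw [this, h, add_zero]
  · have : y₃ + (-s - t) • (a₁ - a₃) + s • (a₂ - a₃) = y₃ + (s • (a₂ - a₁) + t • (a₃ - a₁)) := by
      module
    rw [this, h, add_zero]

/-- Pairwise separated sites `a₁, a₂, a₃`. -/
structure SeparatedTriple (N : Set (E →L[ℝ] ℝ)) (a₁ a₂ a₃ : E) : Prop where
  sep₁₂ : Separates N a₁ a₂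
  sep₁₃ : Separates N a₁ a₃
  sep₂₃ : Separates N a₂ a₃

lemma IsMaxOf.activePos_triple (hgN : IsMaxOf g N) {a₁ a₂ a₃ x : E} (hs : SeparatedTriple N a₁ a₂ a₃)
    (h₂ : g (x - a₁) = g (x - a₂)) (h₃ : g (x - a₁) = g (x - a₃)) {r : ℝ} (hr : 0 < r) :
    (ActivePos g N (r • (x - a₁)) (a₂ - a₁) ∧ ActivePos g N (r • (x - a₁)) (a₃ - a₁)) ∧
    (ActivePos g N (r • (x - a₂)) (a₁ - a₂) ∧ ActivePos g N (r • (x - a₂)) (a₃ - a₂)) ∧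
    (ActivePos g N (r • (x - a₃)) (a₁ - a₃) ∧ ActivePos g N (r • (x - a₃)) (a₂ - a₃)) :=
  ⟨⟨hgN.activePos_smul_sub hs.sep₁₂ h₂ hr, hgN.activePos_smul_sub hs.sep₁₃ h₃ hr⟩,
    ⟨hgN.activePos_smul_sub hs.sep₁₂.symm h₂.symm hr,
      hgN.activePos_smul_sub hs.sep₂₃ (h₂.symm.trans h₃) hr⟩,
    ⟨hgN.activePos_smul_sub hs.sep₁₃.symm h₃.symm hr,
      hgN.activePos_smul_sub hs.sep₂₃.symm (h₃.symm.trans h₂) hr⟩⟩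

/-- A point `x` of the bisector is determined by `(x - a₁) / dist(a₁, x)` modulo the plane spanned
by `a₂ - a₁` and `a₃ - a₁`. -/
lemma IsMaxOf.eq_of_inv_smul_sub_eq (hgN : IsMaxOf g N) {a₁ a₂ a₃ x x' : E}
    (hs : SeparatedTriple N a₁ a₂ a₃) (hx : 0 < g (x - a₁)) (hx' : 0 < g (x' - a₁))
    (h₂ : g (x - a₁) = g (x - a₂)) (h₃ : g (x - a₁) = g (x - a₃))
    (h₂' : g (x' - a₁) = g (x' - a₂)) (h₃' : g (x' - a₁) = g (x' - a₃)) {s t : ℝ}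
    (h : (g (x' - a₁))⁻¹ • (x' - a₁) =
      (g (x - a₁))⁻¹ • (x - a₁) + s • (a₂ - a₁) + t • (a₃ - a₁)) : x = x' := by
  set r := (g (x - a₁))⁻¹ with hr
  set r' := (g (x' - a₁))⁻¹ with hr'
  have hr0 : 0 < r := inv_pos.mpr hx
  have hr0' : 0 < r' := inv_pos.mpr hx'
  obtain ⟨p₁, p₂, p₃⟩ := hgN.activePos_triple hs h₂ h₃ hr0
  obtain ⟨q₁, q₂, q₃⟩ := hgN.activePos_triple hs h₂' h₃' hr0'
  have one : r * g (x - a₁) = 1 := inv_mul_cancel₀ hx.ne'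
  have one' : r' * g (x' - a₁) = 1 := inv_mul_cancel₀ hx'.ne'
  have e₂ : r' • (x' - a₂) =
      r • (x - a₂) + (r' - r - s - t) • (a₁ - a₂) + t • (a₃ - a₂) := by
    have e : r' • (x' - a₂) = r' • (x' - a₁) - r' • (a₂ - a₁) := by module
    rw [e, h]; module
  have e₃ : r' • (x' - a₃) =
      r • (x - a₃) + (r' - r - s - t) • (a₁ - a₃) + s • (a₂ - a₃) := by
    have e : r' • (x' - a₃) = r' • (x' - a₁) - r' • (a₃ - a₁) := by module
    rw [e, h]; module
  obtain ⟨c₁, rfl, rfl⟩ := hgN.coeff_eq_zero h e₂ e₃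
    (by rw [hgN.smul hr0.le, hgN.smul hr0'.le, one, one'])
    (by rw [hgN.smul hr0.le, hgN.smul hr0'.le, ← h₂, ← h₂', one, one'])
    (by rw [hgN.smul hr0.le, hgN.smul hr0'.le, ← h₃, ← h₃', one, one'])
    p₁ p₂ p₃ q₁ q₂ q₃
  have e : r' = r := by linarith
  rw [e, zero_smul, zero_smul, add_zero, add_zero] at h
  exact (sub_left_injective (smul_right_injective E hr0.ne' h)).symm

/-- Small transversal displacements `u` of `(x₀ - a₁) / dist(a₁, x₀)` are realized, up to the plane
of the three sites, by points of the bisector close to `x₀`. -/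
lemma IsMaxOf.eventually_exists_bisector (hgN : IsMaxOf g N) (hg : Continuous g) {a₁ a₂ a₃ x₀ : E}
    (hs : SeparatedTriple N a₁ a₂ a₃) (hx₀ : 0 < g (x₀ - a₁))
    (h₂ : g (x₀ - a₁) = g (x₀ - a₂)) (h₃ : g (x₀ - a₁) = g (x₀ - a₃))
    {S : Set E} (hS : S ∈ 𝓝 x₀) :
    ∀ᶠ u in 𝓝 (0 : E), ∃ x ∈ S, g (x - a₁) = g (x - a₂) ∧ g (x - a₁) = g (x - a₃) ∧
      ∃ s t : ℝ, (g (x - a₁))⁻¹ • (x - a₁) =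
        (g (x₀ - a₁))⁻¹ • (x₀ - a₁) + u + s • (a₂ - a₁) + t • (a₃ - a₁) := by
  set r := (g (x₀ - a₁))⁻¹ with hr
  have hr0 : 0 < r := inv_pos.mpr hx₀
  have one : r * g (x₀ - a₁) = 1 := inv_mul_cancel₀ hx₀.ne'
  obtain ⟨p₁, p₂, p₃⟩ := hgN.activePos_triple hs h₂ h₃ hr0
  obtain ⟨ε₁, hε₁, m₁⟩ := hgN.exists_strictMonoOnSquare hg p₁.1 p₁.2
  obtain ⟨ε₂, hε₂, m₂⟩ := hgN.exists_strictMonoOnSquare hg p₂.1 p₂.2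
  obtain ⟨ε₃, hε₃, m₃⟩ := hgN.exists_strictMonoOnSquare hg p₃.1 p₃.2
  set y₁ := r • (x₀ - a₁) with hy₁
  set y₂ := r • (x₀ - a₂) with hy₂
  set y₃ := r • (x₀ - a₃) with hy₃
  -- The point of the bisector with coordinates `u` and `γ`.
  set X : E × ℝ × ℝ × ℝ → E := fun q => (r + (q.2.1 + q.2.2.1 + q.2.2.2))⁻¹ •
    (y₁ + q.1 + q.2.2.1 • (a₂ - a₁) + q.2.2.2 • (a₃ - a₁)) + a₁ with hX
  have hscale : ∀ᶠ q : E × ℝ × ℝ × ℝ in 𝓝 (0, 0, 0, 0),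
      0 < r + (q.2.1 + q.2.2.1 + q.2.2.2) := by
    have hc : Continuous fun q : E × ℝ × ℝ × ℝ => r + (q.2.1 + q.2.2.1 + q.2.2.2) := by fun_prop
    exact (hc.tendsto (0, 0, 0, 0)).eventually (lt_mem_nhds (by simpa using hr0))
  have hXS : ∀ᶠ q in 𝓝 (0, 0, 0, 0), X q ∈ S := by
    have hc : ContinuousAt X (0, 0, 0, 0) := by
      have h1 : ContinuousAt (fun q : E × ℝ × ℝ × ℝ => (r + (q.2.1 + q.2.2.1 + q.2.2.2))⁻¹)
          (0, 0, 0, 0) := ContinuousAt.inv₀ (by fun_prop) (by simpa using hr0.ne')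
      have h2 : ContinuousAt (fun q : E × ℝ × ℝ × ℝ =>
          y₁ + q.1 + q.2.2.1 • (a₂ - a₁) + q.2.2.2 • (a₃ - a₁)) (0, 0, 0, 0) := by fun_prop
      exact (h1.smul h2).add continuousAt_const
    have hX0 : X (0, 0, 0, 0) = x₀ := by
      simp [hX, hy₁, smul_smul, inv_mul_cancel₀ hr0.ne']
    exact hc.eventually (by rw [hX0]; exact hS)
  have hboth := hscale.and hXS
  rw [nhds_prod_eq, eventually_prod_iff] at hboth
  obtain ⟨P, hP, Q, hQ, hPQ⟩ := hboth
  obtain ⟨ρ, hρ, hρQ⟩ := Metric.mem_nhds_iff.mp hQ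
  set ε := min (ρ / 2) (min ε₁ (min ε₂ ε₃)) with hε
  have hε0 : 0 < ε := by positivity
  have hερ : ε < ρ := (min_le_left _ _).trans_lt (by linarith)
  have hε1 : ε ≤ ε₁ := (min_le_right _ _).trans (min_le_left _ _)
  have hε2 : ε ≤ ε₂ := (min_le_right _ _).trans ((min_le_right _ _).trans (min_le_left _ _))
  have hε3 : ε ≤ ε₃ := (min_le_right _ _).trans ((min_le_right _ _).trans (min_le_right _ _))
  have shift : ∀ y : E, Tendsto (fun u : E => y + u) (𝓝 0) (𝓝 y) := fun y => by
    simpa using (by fun_prop : Continuous fun u : E => y + u).tendsto 0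
  have hone₁ : g y₁ = 1 := by rw [hy₁, hgN.smul hr0.le, one]
  have hone₂ : g y₂ = 1 := by rw [hy₂, hgN.smul hr0.le, ← h₂, one]
  have hone₃ : g y₃ = 1 := by rw [hy₃, hgN.smul hr0.le, ← h₃, one]
  have hsol := eventually_exists_solution (u₀ := (0 : E))
    (F₁ := fun u s t => g (y₁ + u + s • (a₂ - a₁) + t • (a₃ - a₁)) - 1)
    (F₂ := fun u s t => g (y₂ + u + s • (a₁ - a₂) + t • (a₃ - a₂)) - 1)
    (F₃ := fun u s t => g (y₃ + u + s • (a₁ - a₃) + t • (a₂ - a₃)) - 1)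
    (by fun_prop) (by fun_prop) (by fun_prop) (by simp [hone₁]) (by simp [hone₂])
    (by simp [hone₃]) hε0 (by
      filter_upwards [(shift y₁).eventually m₁, (shift y₂).eventually m₂, (shift y₃).eventually m₃]
        with u k₁ k₂ k₃
      exact ⟨k₁ ε hε1, k₂ ε hε2, k₃ ε hε3⟩)
  filter_upwards [hsol, hP] with u ⟨γ₁, i₁, γ₂, i₂, γ₃, i₃, f₁, f₂, f₃⟩ hu
  have abs_lt' : ∀ s ∈ Icc (-ε) ε, |s| < ρ := fun s hs =>
    abs_lt.mpr ⟨by linarith [hs.1], by linarith [hs.2]⟩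
  have hγ : (γ₁, γ₂, γ₃) ∈ Metric.ball ((0, 0, 0) : ℝ × ℝ × ℝ) ρ := by
    rw [← Prod.zero_eq_mk, ← Prod.zero_eq_mk, mem_ball_zero_iff]
    exact max_lt (abs_lt' _ i₁) (max_lt (abs_lt' _ i₂) (abs_lt' _ i₃))
  obtain ⟨hpos, hmem⟩ := hPQ hu (hρQ hγ)
  simp only at hpos
  set R := r + (γ₁ + γ₂ + γ₃) with hR
  set z := y₁ + u + γ₂ • (a₂ - a₁) + γ₃ • (a₃ - a₁) with hz
  have hx : X (u, γ₁, γ₂, γ₃) = R⁻¹ • z + a₁ := rfl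
  rw [hx] at hmem
  have hi : 0 ≤ R⁻¹ := (inv_pos.mpr hpos).le
  have d₁ : g (R⁻¹ • z + a₁ - a₁) = R⁻¹ := by
    rw [add_sub_cancel_right, hgN.smul hi, sub_eq_zero.mp f₁, mul_one]
  have hsub : ∀ a, R⁻¹ • z + a₁ - a = R⁻¹ • (z - R • (a - a₁)) := by
    intro a
    rw [smul_sub, smul_smul, inv_mul_cancel₀ hpos.ne']
    module
  have d₂ : g (R⁻¹ • z + a₁ - a₂) = R⁻¹ := by
    have e : z - R • (a₂ - a₁) = y₂ + u + γ₁ • (a₁ - a₂) + γ₃ • (a₃ - a₂) := by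
      rw [hz, hR, hy₁, hy₂]; module
    rw [hsub, hgN.smul hi, e, sub_eq_zero.mp f₂, mul_one]
  have d₃ : g (R⁻¹ • z + a₁ - a₃) = R⁻¹ := by
    have e : z - R • (a₃ - a₁) = y₃ + u + γ₁ • (a₁ - a₃) + γ₂ • (a₂ - a₃) := by
      rw [hz, hR, hy₁, hy₃]; module
    rw [hsub, hgN.smul hi, e, sub_eq_zero.mp f₃, mul_one]
  refine ⟨_, hmem, d₁.trans d₂.symm, d₁.trans d₃.symm, γ₂, γ₃, ?_⟩
  rw [d₁, inv_inv, add_sub_cancel_right, smul_smul, mul_inv_cancel₀ hpos.ne', one_smul]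

/-- Three pairwise separated sites have an equidistant point if each of them has a point at which
all active functionals are smallest on that site. -/
lemma IsMaxOf.exists_equidistant (hgN : IsMaxOf g N) (hg : Continuous g)
    (hpos : ∀ y, y ≠ 0 → 0 < g y) {a₁ a₂ a₃ y₁ y₂ y₃ : E} (hs : SeparatedTriple N a₁ a₂ a₃)
    (h₁₂ : a₁ ≠ a₂) (h₁₃ : a₁ ≠ a₃) (h₂₃ : a₂ ≠ a₃)
    (h₁ : ActivePos g N y₁ (a₂ - a₁) ∧ ActivePos g N y₁ (a₃ - a₁))
    (h₂ : ActivePos g N y₂ (a₁ - a₂) ∧ ActivePos g N y₂ (a₃ - a₂))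
    (h₃ : ActivePos g N y₃ (a₁ - a₃) ∧ ActivePos g N y₃ (a₂ - a₃)) :
    ∃ x, g (x - a₁) = g (x - a₂) ∧ g (x - a₁) = g (x - a₃) := by
  have hz : g 0 = 0 := by simpa using hgN.smul le_rfl (0 : E)
  have hnn : ∀ y, 0 ≤ g y := fun y => by
    rcases eq_or_ne y 0 with rfl | h
    · exact hz.ge
    · exact (hpos y h).le
  have near : ∀ a b : E, g (a - a) ≤ g (a - b) := fun a b => by
    rw [sub_self, hz]
    exact hnn _
  refine exists_eq_of_isPreconnected (f₁ := fun x => g (x - a₁)) (f₂ := fun x => g (x - a₂))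
    (f₃ := fun x => g (x - a₃)) (by fun_prop) (by fun_prop) (by fun_prop)
    (hgN.isPreconnected_bisector hg hpos h₁₂ hs.sep₁₂)
    (hgN.isPreconnected_bisector hg hpos h₁₃ hs.sep₁₃)
    (hgN.isPreconnected_bisector hg hpos h₂₃ hs.sep₂₃)
    ⟨a₁, near _ _, near _ _⟩ ⟨a₂, near _ _, near _ _⟩ ⟨a₃, near _ _, near _ _⟩
    (hgN.exists_farthest hg h₁.1 h₁.2) (hgN.exists_farthest hg h₂.1 h₂.2)
    (hgN.exists_farthest hg h₃.1 h₃.2)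

/-- If `p` is a linear surjection whose kernel is the plane of the three sites, then
`x ↦ p (x - a₁) / dist(a₁, x)` is an open embedding of the bisector. -/
lemma IsMaxOf.isOpenEmbedding_bisector {F : Type*} [NormedAddCommGroup F] [NormedSpace ℝ F]
    [FiniteDimensional ℝ F]
    (hgN : IsMaxOf g N) (hg : Continuous g) (hpos : ∀ y, y ≠ 0 → 0 < g y) {a₁ a₂ a₃ : E}
    (hs : SeparatedTriple N a₁ a₂ a₃) (h₁₂ : a₁ ≠ a₂) {p : E →L[ℝ] F}
    (hp : Function.Surjective p)
    (hker : LinearMap.ker p.toLinearMap = Submodule.span ℝ {a₂ - a₁, a₃ - a₁}) {B : Set E}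
    (hB : B = {x | g (x - a₁) = g (x - a₂) ∧ g (x - a₁) = g (x - a₃)}) :
    IsOpenEmbedding fun x : B => (g (x - a₁))⁻¹ • p (x - a₁) := by
  subst hB
  set B : Set E := {x | g (x - a₁) = g (x - a₂) ∧ g (x - a₁) = g (x - a₃)} with hB
  have hBpos : ∀ x ∈ B, 0 < g (x - a₁) := by
    intro x hx
    by_cases h : x = a₁
    · rw [hx.1]
      exact hpos _ (sub_ne_zero.mpr (h ▸ h₁₂))
    · exact hpos _ (sub_ne_zero.mpr h)
  have hpker : ∀ s t : ℝ, p (s • (a₂ - a₁) + t • (a₃ - a₁)) = 0 := by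
    intro s t
    have : s • (a₂ - a₁) + t • (a₃ - a₁) ∈ LinearMap.ker p.toLinearMap := by
      rw [hker]
      exact Submodule.mem_span_pair.mpr ⟨s, t, rfl⟩
    exact this
  refine IsOpenEmbedding.of_continuous_injective_isOpenMap ?_ ?_ ?_
  · refine Continuous.smul (Continuous.inv₀ (by fun_prop) fun x => (hBpos x x.2).ne') (by fun_prop)
  · intro x x' h
    have h' : (g (x' - a₁))⁻¹ • ((x' : E) - a₁) - (g (x - a₁))⁻¹ • ((x : E) - a₁) ∈
        LinearMap.ker p.toLinearMap := by
      simp only [LinearMap.mem_ker, ContinuousLinearMap.coe_coe, map_sub p (_ • _), map_smul]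
      exact sub_eq_zero.mpr h.symm
    rw [hker] at h'
    obtain ⟨s, t, hst⟩ := Submodule.mem_span_pair.mp h'
    refine Subtype.ext (hgN.eq_of_inv_smul_sub_eq (s := s) (t := t) hs (hBpos x x.2)
      (hBpos x' x'.2) x.2.1 x.2.2 x'.2.1 x'.2.2 ?_)
    rw [add_assoc, hst]
    abel
  · rw [isOpenMap_iff_nhds_le]
    intro x W hW
    obtain ⟨S, hS, hSW⟩ := mem_nhds_subtype _ _ _ |>.mp (mem_map.mp hW)
    obtain ⟨σ, hσ⟩ := p.toLinearMap.exists_rightInverse_of_surjective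
      (LinearMap.range_eq_top.mpr hp)
    have hσ' : ∀ u, p (σ u) = u := fun u => LinearMap.congr_fun hσ u
    set w := (g (x - a₁))⁻¹ • p (x - a₁) with hw
    have hσt : Tendsto (fun u => σ (u - w)) (𝓝 w) (𝓝 0) := by
      have hc : Continuous fun u => σ (u - w) :=
        σ.continuous_of_finiteDimensional.comp (by fun_prop)
      simpa using hc.tendsto w
    filter_upwards [hσt.eventually
      (hgN.eventually_exists_bisector hg hs (hBpos x x.2) x.2.1 x.2.2 hS)]
      with u ⟨z, hzS, hz₂, hz₃, s, t, hst⟩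
    have hu := congrArg p hst
    rw [add_assoc, map_add, map_add, hpker, add_zero, hσ', map_smul, map_smul, ← hw,
      add_sub_cancel] at hu
    have := hSW (show (⟨z, hz₂, hz₃⟩ : B) ∈ Subtype.val ⁻¹' S from hzS)
    rw [← hu]
    exact this

end ThreeSites

section Polytope

variable {d : ℕ}

local notation "𝔼" => EuclideanSpace ℝ (Fin d)

/-- At a point of the halfsphere in direction `v`, all active facet functionals are positive
on `v`. -/
lemma activePos_of_mem_halfsphere {K : Set 𝔼} {N : Set (𝔼 →L[ℝ] ℝ)} (hc : Convex ℝ K)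
    (h0 : K ∈ 𝓝 0) (hN : IsMaxOf (gauge K) N) {v y : 𝔼} (hy : y ∈ halfsphere K v) :
    ActivePos (gauge K) N y v := by
  have h1 : gauge K y = 1 := (gauge_eq_one_iff_mem_frontier hc h0).mpr hy.1
  intro n hn hny
  refine hy.2 n (fun k hk => ?_) ?_
  · rw [hny, h1]
    exact (hN.le n hn k).trans (gauge_le_one_of_mem hk)
  · rintro rfl
    rw [h1] at hny
    simp at hny

lemma bis_triple (K : Set 𝔼) (a₁ a₂ a₃ : 𝔼) : bis K {a₁, a₂, a₃} =
    {x | gauge K (x - a₁) = gauge K (x - a₂) ∧ gauge K (x - a₁) = gauge K (x - a₃)} := by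
  ext x
  simp only [bis, mdist, mem_insert_iff, mem_singleton_iff, mem_ofPred_eq]
  constructor
  · intro h
    exact ⟨h _ (Or.inl rfl) _ (Or.inr (Or.inl rfl)), h _ (Or.inl rfl) _ (Or.inr (Or.inr rfl))⟩
  · rintro ⟨h₂, h₃⟩ a (rfl | rfl | rfl) b (rfl | rfl | rfl) <;> simp_all

/-- A plane in `ℝ^d` is the kernel of a linear surjection onto `ℝ^(d - 2)`. -/
lemma exists_surjective_ker_eq {v w : 𝔼} (h : LinearIndependent ℝ ![v, w]) :
    2 ≤ d ∧ ∃ p : 𝔼 →L[ℝ] EuclideanSpace ℝ (Fin (d - 2)), Function.Surjective p ∧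
      LinearMap.ker p.toLinearMap = Submodule.span ℝ {v, w} := by
  have h2 : Module.finrank ℝ (Submodule.span ℝ {v, w}) = 2 := by
    have := finrank_span_eq_card h
    rwa [Matrix.range_cons_cons_empty, Fintype.card_fin] at this
  have hd : 2 ≤ d := by
    have := (Submodule.span ℝ {v, w}).finrank_le
    rwa [h2, finrank_euclideanSpace_fin] at this
  have hq := (Submodule.span ℝ {v, w}).finrank_quotient_add_finrank
  rw [h2, finrank_euclideanSpace_fin] at hq
  have hfin : Module.finrank ℝ (𝔼 ⧸ Submodule.span ℝ {v, w}) =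
      Module.finrank ℝ (EuclideanSpace ℝ (Fin (d - 2))) := by
    rw [finrank_euclideanSpace_fin]; omega
  let e := LinearEquiv.ofFinrankEq _ _ hfin
  refine ⟨hd, LinearMap.toContinuousLinearMap
    (e.toLinearMap ∘ₗ (Submodule.span ℝ {v, w}).mkQ), ?_, ?_⟩
  · exact e.surjective.comp (Submodule.mkQ_surjective _)
  · ext x
    simp

end Polytope

end PolyhedralNorm

open PolyhedralNorm in
theorem theorem3p9 {d : ℕ} (K : Set (EuclideanSpace ℝ (Fin d)))
    (hK : PolyhedralNorm.IsPolytope K)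
    (h0 : (0 : EuclideanSpace ℝ (Fin d)) ∈ interior K)
    (a₁ a₂ a₃ : EuclideanSpace ℝ (Fin d))
    (h₁₂ : a₁ ≠ a₂) (h₁₃ : a₁ ≠ a₃) (h₂₃ : a₂ ≠ a₃)
    (hgp : PolyhedralNorm.WeakGeneralPosition K {a₁, a₂, a₃})
    (hs₁ : (PolyhedralNorm.sector K {a₁, a₂, a₃} a₁).Nonempty)
    (hs₂ : (PolyhedralNorm.sector K {a₁, a₂, a₃} a₂).Nonempty)
    (hs₃ : (PolyhedralNorm.sector K {a₁, a₂, a₃} a₃).Nonempty) :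
    2 ≤ d ∧ ∃ U : Set (EuclideanSpace ℝ (Fin (d - 2))),
      IsOpen U ∧ U.Nonempty ∧
        Nonempty (PolyhedralNorm.bis K {a₁, a₂, a₃} ≃ₜ U) := by
  obtain ⟨V, hV, rfl⟩ := hK
  have hc : Convex ℝ (convexHull ℝ V) := convex_convexHull ℝ V
  have hn : convexHull ℝ V ∈ nhds (0 : EuclideanSpace ℝ (Fin d)) :=
    mem_interior_iff_mem_nhds.mp h0
  have hb : Bornology.IsVonNBounded ℝ (convexHull ℝ V) :=
    (NormedSpace.isVonNBounded_iff ℝ).mpr (isBounded_convexHull.mpr hV.isBounded)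
  have hg : Continuous (gauge (convexHull ℝ V)) := continuous_gauge hc hn
  have hpos : ∀ y, y ≠ 0 → 0 < gauge (convexHull ℝ V) y := fun y hy =>
    (gauge_pos (absorbent_nhds_zero hn) hb).mpr hy
  have hgN := isMaxOf_gauge hV hn
  have hs : SeparatedTriple ((polarSet V).extremePoints ℝ) a₁ a₂ a₃ :=
    ⟨fun l hl => apply_sub_ne_zero_of_weakGeneralPosition hV hgp hl (by simp) (by simp) h₁₂,
      fun l hl => apply_sub_ne_zero_of_weakGeneralPosition hV hgp hl (by simp) (by simp) h₁₃,
      fun l hl => apply_sub_ne_zero_of_weakGeneralPosition hV hgp hl (by simp) (by simp) h₂₃⟩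
  have act : ∀ a b y : EuclideanSpace ℝ (Fin d), b ∈ ({a₁, a₂, a₃} : Set _) → b ≠ a →
      y ∈ sector (convexHull ℝ V) {a₁, a₂, a₃} a →
      ActivePos (gauge (convexHull ℝ V)) ((polarSet V).extremePoints ℝ) y (b - a) :=
    fun a b y hb hba hy => activePos_of_mem_halfsphere hc hn hgN (hy.2 b ⟨hb, hba⟩)
  obtain ⟨y₁, hy₁⟩ := hs₁
  obtain ⟨y₂, hy₂⟩ := hs₂
  obtain ⟨y₃, hy₃⟩ := hs₃
  have t₁ := And.intro (act a₁ a₂ y₁ (by simp) h₁₂.symm hy₁) (act a₁ a₃ y₁ (by simp) h₁₃.symm hy₁)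
  have t₂ := And.intro (act a₂ a₁ y₂ (by simp) h₁₂ hy₂) (act a₂ a₃ y₂ (by simp) h₂₃.symm hy₂)
  have t₃ := And.intro (act a₃ a₁ y₃ (by simp) h₁₃ hy₃) (act a₃ a₂ y₃ (by simp) h₂₃ hy₃)
  obtain ⟨hd, p, hp, hker⟩ := exists_surjective_ker_eq (hgN.linearIndependent t₁ t₂ t₃)
  have hemb := hgN.isOpenEmbedding_bisector hg hpos hs h₁₂ hp hker (bis_triple _ a₁ a₂ a₃)
  obtain ⟨x, hx⟩ := hgN.exists_equidistant hg hpos hs h₁₂ h₁₃ h₂₃ t₁ t₂ t₃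
  have hx' : x ∈ bis (convexHull ℝ V) {a₁, a₂, a₃} := by
    rw [bis_triple]
    exact hx
  exact ⟨hd, _, hemb.isOpen_range, ⟨_, mem_range_self ⟨x, hx'⟩⟩,
    ⟨hemb.isEmbedding.toHomeomorph⟩⟩
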